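/- Let $G$ be a complex reductive group and $K\subset G$ a maximal compact subgroup, so that $G=K_{\mathbb C}$; concretely, $G$ is a Zariski closed subgroup of $\mathrm{GL}_n(\mathbb C)$ that is stable under conjugate transposition and $K=G\cap \mathrm U(n)$ (every complex reductive group with a maximal compact subgroup is isomorphic to such a pair). Let $G$ act linearly and algebraically on a finite-dimensional complex vector space $V$ with a Hermitian inner product $H$ (linear in the first variable) for which $K$ acts unitarily, and let $\rho:G\to\mathbb C^*$ be a character; then $\rho(K)\subset \mathrm U(1)$. Let $\mathfrak K=\mathrm{Lie}\,K$ and fix an inner product $(\cdot,\cdot)$ on $\mathfrak K$, with norm $\|\cdot\|$, invariant under the adjoint action of $K$. For $\alpha\in\mathfrak K$ and $v\in V$ let $\alpha_v=\frac{d}{dt}\exp(t\alpha)\cdot v|_{t=0}$ be the infinitesimal action. The moment map shifted by $\rho$ is $\mu:V\to\mathfrak K^*$, $$\mu(v)\cdot\alpha=\frac1{2\pi i}\bigl(H(\alpha_v,v)-d\rho\cdot\alpha\bigr),$$ and $\mu^*(v)\in\mathfrak K$ is the element with $(\mu^*(v),\alpha)=\mu(v)\cdot\alpha$ for all $\alpha\in\mathfrak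 K$; put $\|\mu\|^2(v)=\|\mu^*(v)\|^2$. A critical point $v$ of $\|\mu\|^2:V\to\mathbb R$ is called minimal if $\mu(v)=0$ and non-minimal otherwise. A 1-PS of $G$ is a non-trivial algebraic homomorphism $\lambda:\mathbb C^*\to G$; $(\rho,\lambda)$ is the integer with $\rho(\lambda(t))=t^{(\rho,\lambda)}$, and $\|\lambda\|$ is the norm of $\frac{d}{dt}\lambda'(e^{2\pi i t})|_{t=0}\in\mathfrak K$ for any $G$-conjugate $\lambda'$ of $\lambda$ with $\lambda'(S^1)\subset K$. For $v\in V$ put $$M(v)=\inf_\lambda\frac{(\rho,\lambda)}{\|\lambda\|},$$ the infimum over all 1-PSs $\lambda$ of $G$ for which $\lim_{t\to0}\lambda(t)\cdot v$ exists, and $M(v)=0$ if there is no such $\lambda$. Let $v\in V$ and $\beta=\mu^*(v)$. Then the following are equivalent: (i) $v$ is a non-minimal critical point of $\|\mu\|^2$; (ii) $\beta\neq0$ and $\beta_v=0$; (iii) $-M(v)=\|\beta\|>0$. -/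

import Mathlib

open Filter Topology

namespace ReductiveAction

noncomputable section

/-- A complex reductive group `G`, given as a Zariski closed subgroup of `GL_n(ℂ)` that is stable
under conjugate transposition `g ↦ gᴴ`. Its maximal compact subgroup is `K = G ∩ U(n)` (see
`compactForm`) and `G` is the complexification of `K`; every complex reductive group together with
a maximal compact subgroup is isomorphic to such a pair. -/
structure ComplexReductiveGroup (n : ℕ) where
  /-- the underlying subgroup of `GL_n(ℂ)` -/
  toSubgroup : Subgroup (GL (Fin n) ℂ)
  zariski_closed : ∃ S : Set (MvPolynomial (Fin n × Fin n) ℂ), ∀ g : GL (Fin n) ℂ,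
    g ∈ toSubgroup ↔
      ∀ p ∈ S, MvPolynomial.eval (fun ij : Fin n × Fin n => (g : Matrix _ _ ℂ) ij.1 ij.2) p = 0
  star_mem : ∀ g ∈ toSubgroup, star g ∈ toSubgroup

/-- The invertible matrix `exp X`. -/
def expGL {n : ℕ} (X : Matrix (Fin n) (Fin n) ℂ) : GL (Fin n) ℂ :=
  (Matrix.isUnit_exp X).unit

@[simp]
lemma coe_expGL {n : ℕ} (X : Matrix (Fin n) (Fin n) ℂ) :
    (expGL X : Matrix (Fin n) (Fin n) ℂ) = NormedSpace.exp X := rfl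

section Trotter

open scoped Matrix.Norms.L2Operator

lemma norm_pow_sub_pow_le {R : Type*} [NormedRing R] {A B : R}
    (hA : ∀ k : ℕ, ‖A ^ k‖ ≤ 1) (hB : ∀ k : ℕ, ‖B ^ k‖ ≤ 1) (m : ℕ) :
    ‖A ^ m - B ^ m‖ ≤ m * ‖A - B‖ := by
  induction m with
  | zero => simp
  | succ m ih =>
    have h : A ^ (m + 1) - B ^ (m + 1) = A ^ m * (A - B) + (A ^ m - B ^ m) * B := by
      rw [pow_succ, pow_succ]; noncomm_ring
    rw [h]
    calc ‖A ^ m * (A - B) + (A ^ m - B ^ m) * B‖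
        ≤ ‖A ^ m‖ * ‖A - B‖ + ‖A ^ m - B ^ m‖ * ‖B‖ :=
          (norm_add_le _ _).trans (add_le_add (norm_mul_le _ _) (norm_mul_le _ _))
      _ ≤ 1 * ‖A - B‖ + (m * ‖A - B‖) * 1 := by
          gcongr
          · exact hA m
          · simpa using hB 1
      _ = ((m + 1 : ℕ) : ℝ) * ‖A - B‖ := by push_cast; ring

lemma norm_le_one_of_unitary {n : ℕ} {A : Matrix (Fin n) (Fin n) ℂ} (h : star A * A = 1) :
    ‖A‖ ≤ 1 := by
  have h1 : ‖A‖ * ‖A‖ = ‖(1 : Matrix (Fin n) (Fin n) ℂ)‖ := by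
    rw [← CStarRing.norm_star_mul_self, h]
  have h2 : ‖(1 : Matrix (Fin n) (Fin n) ℂ)‖ ≤ 1 := by
    have h3 : ‖(1 : Matrix (Fin n) (Fin n) ℂ)‖ * ‖(1 : Matrix (Fin n) (Fin n) ℂ)‖
        = ‖(1 : Matrix (Fin n) (Fin n) ℂ)‖ := by
      rw [← CStarRing.norm_star_mul_self]; simp
    nlinarith [norm_nonneg (1 : Matrix (Fin n) (Fin n) ℂ)]
  nlinarith [norm_nonneg A]

lemma star_pow_mul_pow {n : ℕ} {A : Matrix (Fin n) (Fin n) ℂ} (h : star A * A = 1) (k : ℕ) :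
    star (A ^ k) * A ^ k = 1 := by
  induction k with
  | zero => simp
  | succ k ih =>
    rw [pow_succ', star_mul]
    calc star (A ^ k) * star A * (A * A ^ k) = star (A ^ k) * (star A * A) * A ^ k := by
          noncomm_ring
      _ = 1 := by rw [h, mul_one, ih]

lemma star_eq_neg_of_exp_unitary {n : ℕ} {X : Matrix (Fin n) (Fin n) ℂ}
    (h : ∀ t : ℝ, star (NormedSpace.exp (t • X)) * NormedSpace.exp (t • X) = 1) :
    star X = -X := by
  have h1 : HasDerivAt (fun t : ℝ => NormedSpace.exp (t • X)) X 0 := by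
    simpa using hasDerivAt_exp_smul_const (𝕂 := ℝ) X (0 : ℝ)
  have h2 : HasDerivAt (fun t : ℝ => star (NormedSpace.exp (t • X))) (star X) 0 := h1.star
  have h3 := h2.mul h1
  have h4 : ((fun t : ℝ => star (NormedSpace.exp (t • X))) *
      fun t : ℝ => NormedSpace.exp (t • X)) = fun _ => 1 := funext h
  rw [h4] at h3
  have h5 := h3.unique (hasDerivAt_const (0 : ℝ) (1 : Matrix (Fin n) (Fin n) ℂ))
  simp at h5
  exact eq_neg_of_add_eq_zero_left h5

lemma exp_unitary_of_star_eq_neg {n : ℕ} {X : Matrix (Fin n) (Fin n) ℂ} (h : star X = -X)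
    (t : ℝ) : star (NormedSpace.exp (t • X)) * NormedSpace.exp (t • X) = 1 := by
  have h1 : star (NormedSpace.exp (t • X)) = NormedSpace.exp (-(t • X)) := by
    rw [Matrix.star_eq_conjTranspose, ← Matrix.exp_conjTranspose, Matrix.conjTranspose_smul,
      ← Matrix.star_eq_conjTranspose, h]
    simp
  rw [h1, ← Matrix.exp_add_of_commute _ _ ((Commute.refl (t • X)).neg_left)]
  simp

/-- The product formula `(exp (X/m) exp (Y/m))^m → exp (X + Y)`, for skew-Hermitian matrices. -/
lemma tendsto_trotter {n : ℕ} {X Y : Matrix (Fin n) (Fin n) ℂ}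
    (hX : star X = -X) (hY : star Y = -Y) :
    Tendsto (fun m : ℕ => (NormedSpace.exp (((m : ℝ)⁻¹) • X) *
      NormedSpace.exp (((m : ℝ)⁻¹) • Y)) ^ m) atTop (𝓝 (NormedSpace.exp (X + Y))) := by
  have hXY : star (X + Y) = -(X + Y) := by rw [star_add, hX, hY]; abel
  set D : ℝ → Matrix (Fin n) (Fin n) ℂ := fun t =>
    NormedSpace.exp (t • X) * NormedSpace.exp (t • Y) - NormedSpace.exp (t • (X + Y)) with hD
  have hder : HasDerivAt D 0 0 := by
    have e : ∀ Z : Matrix (Fin n) (Fin n) ℂ,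
        HasDerivAt (fun t : ℝ => NormedSpace.exp (t • Z)) Z 0 := fun Z => by
      simpa using hasDerivAt_exp_smul_const (𝕂 := ℝ) Z (0 : ℝ)
    have h1 := ((e X).mul (e Y)).sub (e (X + Y))
    rw [zero_smul, zero_smul, NormedSpace.exp_zero, mul_one, one_mul, sub_self] at h1
    exact h1
  have hlim : Tendsto (fun m : ℕ => (m : ℝ) • D ((m : ℝ)⁻¹)) atTop (𝓝 0) := by
    have h0 : Tendsto (fun m : ℕ => ((m : ℝ)⁻¹)) atTop (𝓝[≠] 0) := by
      refine tendsto_nhdsWithin_iff.2 ⟨tendsto_inv_atTop_nhds_zero_nat, ?_⟩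
      filter_upwards [eventually_gt_atTop 0] with m hm
      simp; omega
    have h1 := (hasDerivAt_iff_tendsto_slope_zero.1 hder).comp h0
    simpa [Function.comp_def, hD] using h1
  rw [tendsto_iff_norm_sub_tendsto_zero]
  refine squeeze_zero' (Eventually.of_forall fun _ => norm_nonneg _) ?_
    (tendsto_zero_iff_norm_tendsto_zero.1 hlim)
  filter_upwards [eventually_gt_atTop 0] with m hm
  have hm' : (m : ℝ) ≠ 0 := by positivity
  have hB : NormedSpace.exp (X + Y) = NormedSpace.exp (((m : ℝ)⁻¹) • (X + Y)) ^ m := by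
    rw [← Matrix.exp_nsmul, ← Nat.cast_smul_eq_nsmul ℝ, smul_smul, mul_inv_cancel₀ hm', one_smul]
  have uA : star (NormedSpace.exp (((m : ℝ)⁻¹) • X) * NormedSpace.exp (((m : ℝ)⁻¹) • Y)) *
      (NormedSpace.exp (((m : ℝ)⁻¹) • X) * NormedSpace.exp (((m : ℝ)⁻¹) • Y)) = 1 := by
    rw [star_mul, mul_assoc, ← mul_assoc _ (NormedSpace.exp (((m : ℝ)⁻¹) • X)),
      exp_unitary_of_star_eq_neg hX, one_mul, exp_unitary_of_star_eq_neg hY]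
  have uB := exp_unitary_of_star_eq_neg hXY ((m : ℝ)⁻¹)
  rw [hB, norm_smul, Real.norm_natCast]
  exact norm_pow_sub_pow_le (fun k => norm_le_one_of_unitary (star_pow_mul_pow uA k))
    (fun k => norm_le_one_of_unitary (star_pow_mul_pow uB k)) m

end Trotter

namespace ComplexReductiveGroup

variable {n : ℕ} (G : ComplexReductiveGroup n)

/-- The maximal compact subgroup `K = G ∩ U(n)`. -/
def compactForm : Subgroup (GL (Fin n) ℂ) where
  carrier := {g | g ∈ G.toSubgroup ∧ star (g : Matrix (Fin n) (Fin n) ℂ) * g = 1}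
  one_mem' := ⟨one_mem _, by simp⟩
  mul_mem' := by
    rintro a b ⟨ha, ha'⟩ ⟨hb, hb'⟩
    refine ⟨mul_mem ha hb, ?_⟩
    rw [Units.val_mul, star_mul, mul_assoc, ← mul_assoc _ (a : Matrix (Fin n) (Fin n) ℂ), ha',
      one_mul, hb']
  inv_mem' := by
    rintro a ⟨ha, ha'⟩
    refine ⟨inv_mem ha, ?_⟩
    have h : star (a : Matrix (Fin n) (Fin n) ℂ) = ((a⁻¹ : GL (Fin n) ℂ) : Matrix _ _ ℂ) :=
      (Units.inv_eq_of_mul_eq_one_left ha').symm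
    rw [← h, star_star, h, Units.mul_inv]

lemma compactForm_le : G.compactForm ≤ G.toSubgroup := fun _ h => h.1

lemma mem_compactForm_of_tendsto {u : ℕ → GL (Fin n) ℂ} {g : GL (Fin n) ℂ}
    (hu : ∀ m, u m ∈ G.compactForm)
    (h : Tendsto (fun m => (u m : Matrix (Fin n) (Fin n) ℂ)) atTop (𝓝 (g : Matrix _ _ ℂ))) :
    g ∈ G.compactForm := by
  obtain ⟨S, hS⟩ := G.zariski_closed
  refine ⟨(hS g).2 fun p hp => ?_, ?_⟩
  · have hc : Continuous fun M : Matrix (Fin n) (Fin n) ℂ =>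
        MvPolynomial.eval (fun ij : Fin n × Fin n => M ij.1 ij.2) p :=
      (MvPolynomial.continuous_eval p).comp (by fun_prop)
    refine tendsto_nhds_unique ((hc.tendsto _).comp h) ?_
    refine tendsto_const_nhds.congr fun m => ?_
    exact (((hS (u m)).1 (hu m).1) p hp).symm
  · have hc : Continuous fun M : Matrix (Fin n) (Fin n) ℂ => star M * M := by fun_prop
    refine tendsto_nhds_unique ((hc.tendsto _).comp h) ?_
    refine tendsto_const_nhds.congr fun m => ?_
    exact (hu m).2.symm

/-- The real Lie algebra `𝔨 = Lie K = {X : exp (tX) ∈ K for all real t}`. -/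
def lieK : Submodule ℝ (Matrix (Fin n) (Fin n) ℂ) where
  carrier := {X | ∀ t : ℝ, expGL (t • X) ∈ G.compactForm}
  zero_mem' := fun t => by
    have : expGL (t • (0 : Matrix (Fin n) (Fin n) ℂ)) = 1 := Units.ext (by simp)
    rw [this]; exact one_mem _
  smul_mem' := fun c X hX t => by
    rw [smul_smul]; exact hX _
  add_mem' := by
    intro X Y hX hY t
    have sX := star_eq_neg_of_exp_unitary fun s => (hX s).2
    have sY := star_eq_neg_of_exp_unitary fun s => (hY s).2
    have key := tendsto_trotter (X := t • X) (Y := t • Y) (by simp [star_smul, sX])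
      (by simp [star_smul, sY])
    rw [smul_add]
    refine G.mem_compactForm_of_tendsto
      (u := fun m => (expGL (((m : ℝ)⁻¹) • t • X) * expGL (((m : ℝ)⁻¹) • t • Y)) ^ m)
      (fun m => ?_) ?_
    · refine pow_mem (mul_mem ?_ ?_) m
      · rw [smul_smul]; exact hX _
      · rw [smul_smul]; exact hY _
    · simpa using key

/-- For `α ∈ 𝔨` and `t ∈ ℝ`, the element `exp (tα)` of `G` (it lies in `K`). -/
def exp (α : G.lieK) (t : ℝ) : G.toSubgroup :=
  ⟨expGL (t • (α : Matrix (Fin n) (Fin n) ℂ)), G.compactForm_le (α.2 t)⟩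

/-- The adjoint action `Ad k α = k α k⁻¹` of `K` on `𝔨`. -/
def Ad (k : G.compactForm) (α : G.lieK) : G.lieK :=
  ⟨(k : GL (Fin n) ℂ).val * α.val * ((k : GL (Fin n) ℂ)⁻¹).val,
    fun t => by
      have h : expGL (t • ((k : GL (Fin n) ℂ).val * α.val * ((k : GL (Fin n) ℂ)⁻¹).val)) =
          (k : GL (Fin n) ℂ) * expGL (t • α.val) * (k : GL (Fin n) ℂ)⁻¹ := by
        refine Units.ext ?_
        rw [Units.val_mul, Units.val_mul, coe_expGL, coe_expGL, ← Matrix.exp_units_conj,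
          mul_smul_comm, smul_mul_assoc]
      rw [h]
      exact mul_mem (mul_mem k.2 (α.2 t)) (inv_mem k.2)⟩

/-- A regular function on `G`: the restriction of an element of `ℂ[x_{ij}, det⁻¹]`. -/
def IsRegular (f : G.toSubgroup → ℂ) : Prop :=
  ∃ (p : MvPolynomial (Fin n × Fin n) ℂ) (k : ℕ), ∀ g : G.toSubgroup,
    f g = MvPolynomial.eval
        (fun ij : Fin n × Fin n => ((g : GL (Fin n) ℂ) : Matrix _ _ ℂ) ij.1 ij.2) p *
      ((((g : GL (Fin n) ℂ) : Matrix (Fin n) (Fin n) ℂ).det)⁻¹) ^ k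

section

open scoped Matrix.Norms.L2Operator

/-- A regular function is differentiable along `t ↦ exp (tα)`, linearly in `α`. -/
lemma IsRegular.hasDerivAt {G : ComplexReductiveGroup n} {f : G.toSubgroup → ℂ}
    (hf : G.IsRegular f) :
    ∃ L : G.lieK →ₗ[ℝ] ℂ, ∀ α, HasDerivAt (fun t : ℝ => f (G.exp α t)) (L α) 0 := by
  obtain ⟨p, k, h⟩ := hf
  set F : Matrix (Fin n) (Fin n) ℂ → ℂ := fun M =>
    MvPolynomial.eval (fun ij : Fin n × Fin n => M ij.1 ij.2) p * (M.det⁻¹) ^ k with hF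
  have hent : ∀ ij : Fin n × Fin n,
      Differentiable ℝ fun M : Matrix (Fin n) (Fin n) ℂ => M ij.1 ij.2 := fun ij =>
    (LinearMap.toContinuousLinearMap
      ((Matrix.entryLinearMap ℝ ℂ ij.1 ij.2 : Matrix (Fin n) (Fin n) ℂ →ₗ[ℝ] ℂ))).differentiable
  have hp : ∀ q : MvPolynomial (Fin n × Fin n) ℂ,
      Differentiable ℝ fun M : Matrix (Fin n) (Fin n) ℂ =>
        MvPolynomial.eval (fun ij : Fin n × Fin n => M ij.1 ij.2) q := by
    intro q
    induction q using MvPolynomial.induction_on with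
    | C a => simp
    | add p q hp hq => simpa using hp.fun_add hq
    | mul_X p i hp => simpa using hp.fun_mul (hent i)
  have hdet : Differentiable ℝ fun M : Matrix (Fin n) (Fin n) ℂ => M.det := by
    have h1 := hp (Matrix.mvPolynomialX (Fin n) (Fin n) ℂ).det
    simpa only [RingHom.map_det, Matrix.mvPolynomialX_mapMatrix_eval] using h1
  have hFd : DifferentiableAt ℝ F 1 :=
    (hp p 1).mul (((hdet 1).inv (by simp)).pow k)
  refine ⟨(fderiv ℝ F 1).toLinearMap ∘ₗ G.lieK.subtype, fun α => ?_⟩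
  have h1 : HasDerivAt (fun t : ℝ => NormedSpace.exp (t • (α : Matrix (Fin n) (Fin n) ℂ)))
      (α : Matrix (Fin n) (Fin n) ℂ) 0 := by
    simpa using hasDerivAt_exp_smul_const (𝕂 := ℝ) (α : Matrix (Fin n) (Fin n) ℂ) (0 : ℝ)
  have h2 : HasFDerivAt F (fderiv ℝ F 1)
      (NormedSpace.exp ((0 : ℝ) • (α : Matrix (Fin n) (Fin n) ℂ))) := by
    simpa using hFd.hasFDerivAt
  have h3 := h2.comp_hasDerivAt (0 : ℝ) h1
  refine h3.congr_of_eventuallyEq (Eventually.of_forall fun t => ?_)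
  simp only [h]
  rfl

end

/-- A one-parameter subgroup of `G`: a non-trivial homomorphism of algebraic groups `ℂˣ → G`, i.e.
a group homomorphism whose matrix entries are Laurent polynomials `t⁻ᵏ p(t)`. -/
structure OnePS where
  toHom : ℂˣ →* G.toSubgroup
  regular : ∀ i j : Fin n, ∃ (p : Polynomial ℂ) (k : ℕ), ∀ t : ℂˣ,
    ((toHom t : GL (Fin n) ℂ) : Matrix (Fin n) (Fin n) ℂ) i j = ((t⁻¹ : ℂˣ) : ℂ) ^ k * p.eval (t : ℂ)
  nontrivial : ∃ t, toHom t ≠ 1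

/-- A character of `G`: a homomorphism of algebraic groups `G → ℂˣ`. -/
structure Character where
  toHom : G.toSubgroup →* ℂˣ
  regular : G.IsRegular fun g => (toHom g : ℂ)

/-- An inner product on `𝔨` that is invariant under the adjoint action of `K`. -/
structure InvariantInnerProduct where
  form : LinearMap.BilinForm ℝ G.lieK
  symm : ∀ α β, form α β = form β α
  pos : ∀ α, α ≠ 0 → 0 < form α α
  invariant : ∀ (k : G.compactForm) (α β : G.lieK), form (G.Ad k α) (G.Ad k β) = form α β

/-- A linear algebraic action of `G` on the Hermitian vector space `V` (the matrix coefficients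
`g ↦ ⟨w, g v⟩` are regular functions) for which `K` acts by unitary transformations. -/
structure LinearAction (V : Type*) [NormedAddCommGroup V] [InnerProductSpace ℂ V] where
  toHom : G.toSubgroup →* (V →ₗ[ℂ] V)
  regular : ∀ v w : V, G.IsRegular fun g => inner ℂ w (toHom g v)
  unitary : ∀ g : G.toSubgroup, (g : GL (Fin n) ℂ) ∈ G.compactForm →
    ∀ v w : V, inner ℂ (toHom g v) (toHom g w) = inner ℂ v w

variable {G}

/-- The derivative `dρ · α = d/dt ρ(exp (tα))|_{t = 0}`, for `α ∈ 𝔨`. -/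
def Character.d (ρ : G.Character) : G.lieK →ₗ[ℝ] ℂ where
  toFun α := deriv (fun t : ℝ => (ρ.toHom (G.exp α t) : ℂ)) 0
  map_add' α β := by
    obtain ⟨L, hL⟩ := ρ.regular.hasDerivAt
    simp only [(hL _).deriv, map_add]
  map_smul' c α := by
    obtain ⟨L, hL⟩ := ρ.regular.hasDerivAt
    simp only [(hL _).deriv, map_smul, RingHom.id_apply]

open Classical in
/-- The integer `(ρ, λ)` with `ρ(λ(t)) = t ^ (ρ, λ)` for all `t ∈ ℂˣ`. -/
def Character.pairing (ρ : G.Character) (l : G.OnePS) : ℤ :=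
  if h : ∃ m : ℤ, ∀ t : ℂˣ, ρ.toHom (l.toHom t) = t ^ m then h.choose else 0

namespace InvariantInnerProduct

variable (B : G.InvariantInnerProduct)

lemma nondegenerate : B.form.Nondegenerate := by
  refine ⟨fun α h => ?_, fun α h => ?_⟩ <;>
  · by_contra h0
    exact (B.pos α h0).ne' (h α)

/-- The norm `‖α‖ = √(α, α)` on `𝔨`. -/
def norm (α : G.lieK) : ℝ := Real.sqrt (B.form α α)

/-- The norm of a one-parameter subgroup `l`: the norm of the weight
`α = d/dt g l(e^{2πit}) g⁻¹ |_{t = 0} ∈ 𝔨` of any conjugate `g l g⁻¹` that maps the unit circle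
to `K`. Such a conjugate exists and all of them give the same value, so that the infimum is taken
over a set with one element. -/
def normOnePS (l : G.OnePS) : ℝ :=
  sInf {r : ℝ | ∃ (g : G.toSubgroup) (α : G.lieK),
    (∀ t : ℝ, g * l.toHom (Circle.toUnits (Circle.exp (2 * Real.pi * t))) * g⁻¹ = G.exp α t) ∧
      r = B.norm α}

end InvariantInnerProduct

namespace LinearAction

variable {V : Type*} [NormedAddCommGroup V] [InnerProductSpace ℂ V] [FiniteDimensional ℂ V]
  (A : G.LinearAction V)

lemma hasDerivAt (v : V) :
    ∃ L : G.lieK →ₗ[ℝ] V, ∀ α, HasDerivAt (fun t : ℝ => A.toHom (G.exp α t) v) (L α) 0 := by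
  set b := stdOrthonormalBasis ℂ V
  choose L hL using fun i => (A.regular v (b i)).hasDerivAt
  refine ⟨∑ i, ((LinearMap.toSpanSingleton ℂ V (b i)).restrictScalars ℝ) ∘ₗ L i, fun α => ?_⟩
  have h : (fun t : ℝ => A.toHom (G.exp α t) v) =
      fun t : ℝ => ∑ i, (inner ℂ (b i) (A.toHom (G.exp α t) v) : ℂ) • b i :=
    funext fun t => (b.sum_repr' _).symm
  rw [h]
  simpa using HasDerivAt.fun_sum fun i (_ : i ∈ Finset.univ) => (hL i α).smul_const (b i)

/-- The infinitesimal action `α_v = d/dt exp (tα) · v |_{t = 0}` of `α ∈ 𝔨` at `v`. -/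
def infinitesimal (v : V) : G.lieK →ₗ[ℝ] V where
  toFun α := deriv (fun t : ℝ => A.toHom (G.exp α t) v) 0
  map_add' α β := by
    obtain ⟨L, hL⟩ := A.hasDerivAt v
    simp only [(hL _).deriv, map_add]
  map_smul' c α := by
    obtain ⟨L, hL⟩ := A.hasDerivAt v
    simp only [(hL _).deriv, map_smul, RingHom.id_apply]

/-- The moment map shifted by `ρ`, `μ(v) · α = (H(α_v, v) - dρ · α) / (2πi)`. The Hermitian form
`H(x, y)` is linear in `x`, so that it is `inner ℂ y x`. The number on the right is real, because
`K` acts unitarily and `ρ(K) ⊆ U(1)`. -/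
def moment (ρ : G.Character) (v : V) : Module.Dual ℝ G.lieK where
  toFun α := ((inner ℂ v (A.infinitesimal v α) - ρ.d α) / (2 * Real.pi * Complex.I)).re
  map_add' α β := by
    rw [map_add, map_add, inner_add_right, ← Complex.add_re, ← add_div]
    congr 2; ring
  map_smul' c α := by
    rw [map_smul, map_smul, ← Complex.coe_smul c (A.infinitesimal v α), inner_smul_right,
      RingHom.id_apply, smul_eq_mul, ← Complex.re_ofReal_mul, Complex.real_smul]
    congr 1; ring

/-- `μ^*(v) ∈ 𝔨`, the element with `(μ^*(v), α) = μ(v) · α` for all `α ∈ 𝔨`. -/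
def momentStar (ρ : G.Character) (B : G.InvariantInnerProduct) (v : V) : G.lieK :=
  (B.form.toDual B.nondegenerate).symm (A.moment ρ v)

/-- The function `‖μ‖² : V → ℝ`. -/
def normSqMoment (ρ : G.Character) (B : G.InvariantInnerProduct) (v : V) : ℝ :=
  B.norm (A.momentStar ρ B v) ^ 2

/-- `v` is a critical point of `‖μ‖²`: the derivative of `‖μ‖²` (as a function on the real vector
space `V`) vanishes at `v`. -/
def IsCritical (ρ : G.Character) (B : G.InvariantInnerProduct) (v : V) : Prop :=
  HasFDerivAt (A.normSqMoment ρ B) (0 : V →L[ℝ] ℝ) v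

/-- `v` is a non-minimal critical point of `‖μ‖²`; the minimal critical points are the points of
`μ⁻¹(0)`. -/
def IsNonMinimalCritical (ρ : G.Character) (B : G.InvariantInnerProduct) (v : V) : Prop :=
  A.IsCritical ρ B v ∧ A.moment ρ v ≠ 0

/-- The limit `lim_{t → 0} l(t) · v` exists. -/
def HasLimit (v : V) (l : G.OnePS) : Prop :=
  ∃ w : V, Tendsto (fun t : ℂˣ => A.toHom (l.toHom t) v)
    (comap (fun t : ℂˣ => (t : ℂ)) (𝓝 0)) (𝓝 w)

open Classical in
/-- `M(v) = inf (ρ, l) / ‖l‖` over all one-parameter subgroups `l` for which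
`lim_{t → 0} l(t) · v` exists, and `M(v) = 0` if there is no such `l` (`v` is strongly stable). -/
def M (ρ : G.Character) (B : G.InvariantInnerProduct) (v : V) : ℝ :=
  if ∃ l : G.OnePS, A.HasLimit v l then
    sInf {x : ℝ | ∃ l : G.OnePS, A.HasLimit v l ∧ x = (ρ.pairing l : ℝ) / B.normOnePS l}
  else 0

end LinearAction

end ComplexReductiveGroup

end

end ReductiveAction

open ReductiveAction

/-! Write `α` for the generator of a 1-PS `λ` that maps the circle into `K`, and `β = μ^*(v)`.
Decompose `v = ∑ v_j` into weight vectors of `λ`, with weights `w_j`. The unshifted moment map,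
called the energy here, is `E(v) = ∑ w_j ‖v_j‖²`, so that `(β, α) = E(v) - (ρ, λ)`.

(i) ⇔ (ii): `K` acts by unitary maps, so `α` acts by a skew-Hermitian operator. Hence the derivative
of `‖μ‖²` at `v` in the direction `y` is `(2/π) Im ⟨y, β_v⟩`, where `⟨y, z⟩ = H(z, y)`. It vanishes
for all `y` exactly when `β_v = 0` (`isCritical_iff`).

The bound `M(v) ≥ -‖β‖` holds for every `v` (`neg_norm_le_M`). If `λ(t)v` converges, only weights
`w_j ≥ 0` occur in `v`, so `E(v) ≥ 0` and Cauchy-Schwarz gives `-(ρ, λ) ≤ (β, α) ≤ ‖β‖ ‖α‖`. For a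
general `λ` one first passes to a conjugate `gλg⁻¹` that is compatible with `K` and for which the
limit still exists (`OnePS.exists_conj_compact`). The element `g` is the limit of `gλ(t)g⁻¹λ(t)⁻¹`,
so it lies in the parabolic subgroup of `λ`.

(ii) ⇒ (iii): if `β_v = 0`, the Zariski closure of `exp(ℝβ)` fixes `v`. This closure contains 1-PSs
whose directions approximate that of `β` (`exists_onePS_in_torus`). They have zero energy at `v`, so
their ratios `(ρ, λ)/‖λ‖` tend to `-‖β‖`.

(iii) ⇒ (ii): a nearly minimizing `λ` nearly attains equality in Cauchy-Schwarz. Then `α/‖α‖` is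
close to `β/‖β‖` and `E(v)/‖α‖` is small. Cauchy-Schwarz on the weights bounds `‖α_v‖⁴` by `(2π)²
E(v) E(α_v)` (`energy_estimate`), so `α_v/‖α‖` is small and in the limit `β_v = 0`. The infimum need
not be attained. -/

namespace ReductiveAction

noncomputable section

/-! ### Characters and polynomial identities -/

/-- If a polynomial vanishes on the curve `x ↦ ∑ j, χ (d j) x • P j`, where `χ` is an injective
family of characters indexed by an additive monoid, then it vanishes on `∑ j, ψ (d j) • P j` for
every character `ψ` of the index monoid. -/
lemma eval_eq_zero_of_characters {Γ M σ ι : Type*} [AddCommMonoid Γ] [Monoid M] [Fintype ι]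
    (χ : Multiplicative Γ →* (M →* ℂ)) (hχ : Function.Injective χ) (ψ : Multiplicative Γ →* ℂ)
    (P : ι → σ → ℂ) (d : ι → Γ) (p : MvPolynomial σ ℂ)
    (h : ∀ x, MvPolynomial.eval (fun s => ∑ j, χ (.ofAdd (d j)) x * P j s) p = 0) :
    MvPolynomial.eval (fun s => ∑ j, ψ (.ofAdd (d j)) * P j s) p = 0 := by
  -- The universal substitution: `a` lives in the monoid algebra of `Γ`, and each character of `Γ`
  -- evaluates it to the value of `p` at the corresponding point.
  set a : AddMonoidAlgebra ℂ Γ :=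
    MvPolynomial.aeval (fun s => ∑ j, AddMonoidAlgebra.single (d j) (P j s)) p with ha
  have key : ∀ F : Multiplicative Γ →* ℂ, AddMonoidAlgebra.lift ℂ ℂ Γ F a =
      MvPolynomial.eval (fun s => ∑ j, F (.ofAdd (d j)) * P j s) p := by
    intro F
    rw [ha, ← AlgHom.comp_apply, MvPolynomial.comp_aeval, MvPolynomial.aeval_eq_eval]
    congr 2
    ext s
    simp [mul_comm]
  suffices a = 0 by rw [← key, this, map_zero]
  -- Dedekind's independence of characters: the coefficients of `a` form a vanishing linear
  -- combination of distinct characters of `M`.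
  have hli : LinearIndependent ℂ (fun γ : Γ => (χ (.ofAdd γ) : M → ℂ)) :=
    (linearIndependent_monoidHom M ℂ).comp (fun γ : Γ => χ (.ofAdd γ))
      (fun x y hxy => Multiplicative.ofAdd.injective (hχ hxy))
  rw [linearIndependent_iff] at hli
  have : a.coeff = 0 := by
    apply hli
    funext x
    have hx := h x
    rw [show (fun s => ∑ j, χ (.ofAdd (d j)) x * P j s) =
      fun s => ∑ j, ((MonoidHom.eval x).comp χ) (.ofAdd (d j)) * P j s from rfl, ← key,
      AddMonoidAlgebra.lift_apply] at hx
    rw [Finsupp.linearCombination_apply, Finsupp.sum, Finset.sum_apply]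
    exact hx
  exact AddMonoidAlgebra.ext this

/-- An element whose image has infinite order separates the powers of `f`. -/
lemma zpow_hom_injective {M : Type*} [Monoid M] (f : M →* ℂˣ) (x : M)
    (hx : ∀ m : ℤ, f x ^ m = 1 → m = 0) :
    Function.Injective (fun m : ℤ => ((Units.coeHom ℂ).comp ((zpowGroupHom m).comp f) : M →* ℂ)) := by
  intro a b hab
  have h : f x ^ a = f x ^ b := Units.ext (by simpa using DFunLike.congr_fun hab x)
  have := hx (a - b) (by rw [zpow_sub, h, mul_inv_cancel])
  omega

lemma two_zpow_eq_one {m : ℤ} (h : (Units.mk0 (2 : ℂ) two_ne_zero) ^ m = 1) : m = 0 := by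
  have h1 : (2 : ℂ) ^ m = 1 := by simpa using congrArg Units.val h
  have h2 : (2 : ℝ) ^ m = 1 := by simpa using congrArg (fun z : ℂ => ‖z‖) h1
  exact (zpow_eq_one_iff_right₀ (by norm_num) (by norm_num)).1 h2

/-- Vector valued Laurent polynomials with the same values have the same coefficients. -/
lemma eq_of_sum_zpow_smul_eq {ι M : Type*} [Fintype ι] [AddCommGroup M] [Module ℂ M]
    {w : ι → ℤ} (hw : Function.Injective w) {E F : ι → M}
    (h : ∀ t : ℂˣ, ∑ j, ((t : ℂ) ^ w j) • E j = ∑ j, ((t : ℂ) ^ w j) • F j) : E = F := by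
  have hli : LinearIndependent ℂ (fun j : ι => fun t : ℂˣ => (t : ℂ) ^ w j) := by
    have h1 := (linearIndependent_monoidHom ℂˣ ℂ).comp _
      ((zpow_hom_injective (MonoidHom.id ℂˣ) (Units.mk0 (2 : ℂ) two_ne_zero)
        fun m hm => two_zpow_eq_one hm).comp hw)
    have h2 : (fun j : ι => fun t : ℂˣ => (t : ℂ) ^ w j) = (fun f : ℂˣ →* ℂ => (f : ℂˣ → ℂ)) ∘
        ((fun m : ℤ => ((Units.coeHom ℂ).comp ((zpowGroupHom m).comp (MonoidHom.id ℂˣ)) : ℂˣ →* ℂ))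
          ∘ w) := by
      ext j t
      simp
    rw [h2]
    exact h1
  rw [Fintype.linearIndependent_iff] at hli
  funext j
  -- Linear functionals reduce the vector-valued identity to independence of the scalar characters
  -- `t ^ w j`.
  rw [← sub_eq_zero, ← Module.forall_dual_apply_eq_zero_iff ℂ]
  intro f
  refine hli (fun j => f (E j - F j)) ?_ j
  funext t
  have h2 := congrArg f (h t)
  simp only [map_sum, map_smul, smul_eq_mul] at h2
  simp only [map_sub, Finset.sum_apply, Pi.smul_apply, smul_eq_mul, Pi.zero_apply, sub_mul,
    Finset.sum_sub_distrib]
  rw [sub_eq_zero]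
  simpa [mul_comm] using h2

/-- The coefficients of an algebraic homomorphism from `ℂˣ` to the units of an algebra are
complete orthogonal idempotents. -/
lemma completeOrthogonalIdempotents_of_hom {ι R : Type*} [Fintype ι] [Ring R] [Algebra ℂ R]
    {w : ι → ℤ} (hw : Function.Injective w) {E : ι → R} (φ : ℂˣ →* R)
    (h : ∀ t, φ t = ∑ j, ((t : ℂ) ^ w j) • E j) : CompleteOrthogonalIdempotents E := by
  classical
  -- Coefficients in `t` of `φ (t * s) = φ t * φ s`, with `s` fixed; the next claim then compares
  -- coefficients in the second variable.
  have h1 : ∀ s : ℂˣ, (fun j => ((s : ℂ) ^ w j) • E j) = fun j => E j * φ s := by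
    intro s
    refine eq_of_sum_zpow_smul_eq hw fun t => ?_
    have := (h (t * s)).symm.trans ((map_mul φ t s).trans (by rw [h t]))
    simpa [mul_zpow, Finset.sum_mul, smul_smul] using this
  have h2 : ∀ j, (fun i => if j = i then E j else 0) = fun i => E j * E i := by
    intro j
    refine eq_of_sum_zpow_smul_eq hw fun t => ?_
    have := congrFun (h1 t) j
    simp only [h t, Finset.mul_sum, mul_smul_comm] at this
    simpa using this
  refine ⟨OrthogonalIdempotents.iff_mul_eq.2 fun i j => (congrFun (h2 i) j).symm, ?_⟩
  simpa using (h 1).symm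

/-! ### Laurent polynomials -/

/-- A Laurent polynomial function on `ℂˣ`. -/
def IsLaurent (f : ℂˣ → ℂ) : Prop :=
  ∃ (p : Polynomial ℂ) (k : ℕ), ∀ t : ℂˣ, f t = ((t⁻¹ : ℂˣ) : ℂ) ^ k * p.eval (t : ℂ)

namespace IsLaurent

lemma const (c : ℂ) : IsLaurent fun _ => c := ⟨Polynomial.C c, 0, by simp⟩

lemma inv_coe : IsLaurent fun t => ((t⁻¹ : ℂˣ) : ℂ) := ⟨1, 1, by simp⟩

lemma add {f g : ℂˣ → ℂ} (hf : IsLaurent f) (hg : IsLaurent g) :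
    IsLaurent fun t => f t + g t := by
  obtain ⟨p, k, hp⟩ := hf
  obtain ⟨q, l, hq⟩ := hg
  refine ⟨Polynomial.X ^ l * p + Polynomial.X ^ k * q, k + l, fun t => ?_⟩
  have : (t : ℂ) ≠ 0 := t.ne_zero
  simp only [hp, hq, Units.val_inv_eq_inv_val, Polynomial.eval_add, Polynomial.eval_mul,
    Polynomial.eval_pow, Polynomial.eval_X, inv_pow]
  field_simp
  ring

lemma mul {f g : ℂˣ → ℂ} (hf : IsLaurent f) (hg : IsLaurent g) :
    IsLaurent fun t => f t * g t := by
  obtain ⟨p, k, hp⟩ := hf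
  obtain ⟨q, l, hq⟩ := hg
  refine ⟨p * q, k + l, fun t => ?_⟩
  simp only [hp, hq, Polynomial.eval_mul]
  ring

lemma pow {f : ℂˣ → ℂ} (hf : IsLaurent f) (k : ℕ) : IsLaurent fun t => f t ^ k := by
  induction k with
  | zero => simpa using const 1
  | succ k ih => simpa [pow_succ] using ih.mul hf

lemma sum {κ : Type*} {s : Finset κ} {f : κ → ℂˣ → ℂ} (hf : ∀ a, IsLaurent (f a)) :
    IsLaurent fun t => ∑ a ∈ s, f a t := by
  classical
  induction s using Finset.induction_on with
  | empty => simpa using const 0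
  | insert a s ha ih => simpa [Finset.sum_insert ha] using (hf a).add ih

lemma coe : IsLaurent fun t => (t : ℂ) := ⟨Polynomial.X, 0, by simp⟩

lemma zpow (m : ℤ) : IsLaurent fun t => (t : ℂ) ^ m := by
  cases m with
  | ofNat m => simpa using coe.pow m
  | negSucc m => simpa using inv_coe.pow (m + 1)

lemma comp_inv {f : ℂˣ → ℂ} (hf : IsLaurent f) : IsLaurent fun t => f t⁻¹ := by
  obtain ⟨p, k, hp⟩ := hf
  have h2 : ∀ q : Polynomial ℂ, IsLaurent fun t => q.eval ((t⁻¹ : ℂˣ) : ℂ) := by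
    intro q
    induction q using Polynomial.induction_on' with
    | add p q hp hq => simpa using hp.add hq
    | monomial m a => simpa using (const a).mul (inv_coe.pow m)
  simpa [hp] using (coe.pow k).mul (h2 p)

lemma eval_mvPolynomial {σ : Type*} {f : σ → ℂˣ → ℂ} (hf : ∀ s, IsLaurent (f s))
    (p : MvPolynomial σ ℂ) : IsLaurent fun t => MvPolynomial.eval (fun s => f s t) p := by
  induction p using MvPolynomial.induction_on with
  | C a => simpa using const a
  | add p q hp hq => simpa using hp.add hq
  | mul_X p i hp => simpa using hp.mul (hf i)

lemma det {n : ℕ} {f : ℂˣ → Matrix (Fin n) (Fin n) ℂ}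
    (hf : ∀ i j, IsLaurent fun t => f t i j) : IsLaurent fun t => (f t).det := by
  have h := eval_mvPolynomial (f := fun (ij : Fin n × Fin n) t => f t ij.1 ij.2)
    (fun s => hf _ _) (Matrix.mvPolynomialX (Fin n) (Fin n) ℂ).det
  simpa only [RingHom.map_det, Matrix.mvPolynomialX_mapMatrix_eval] using h

/-- The coefficients of a finite family of Laurent polynomials. -/
lemma exists_coeff {κ : Type*} [Fintype κ] {f : κ → ℂˣ → ℂ} (hf : ∀ a, IsLaurent (f a)) :
    ∃ (N k : ℕ) (c : κ → Fin (N + 1) → ℂ),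
      ∀ a t, f a t = ∑ j : Fin (N + 1), (t : ℂ) ^ ((j : ℤ) - k) * c a j := by
  choose p k hp using hf
  -- `t ^ K` is a common denominator, and the sum of the degrees bounds the degree of every
  -- numerator.
  let K := ∑ a, k a
  let q : κ → Polynomial ℂ := fun a => Polynomial.X ^ (K - k a) * p a
  refine ⟨∑ a, (q a).natDegree, K, fun a j => (q a).coeff j, fun a t => ?_⟩
  have ht : (t : ℂ) ≠ 0 := t.ne_zero
  have hk : k a ≤ K := Finset.single_le_sum (f := k) (fun _ _ => Nat.zero_le _) (Finset.mem_univ a)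
  have hd : (q a).natDegree < ∑ a, (q a).natDegree + 1 :=
    Nat.lt_succ_of_le (Finset.single_le_sum (f := fun a => (q a).natDegree)
      (fun _ _ => Nat.zero_le _) (Finset.mem_univ a))
  have h1 : f a t = ((t : ℂ) ^ K)⁻¹ * (q a).eval (t : ℂ) := by
    rw [hp]
    simp only [q, Units.val_inv_eq_inv_val, Polynomial.eval_mul, Polynomial.eval_pow,
      Polynomial.eval_X]
    rw [← mul_assoc]
    congr 1
    rw [inv_pow, eq_inv_mul_iff_mul_eq₀ (pow_ne_zero _ ht), ← div_eq_mul_inv,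
      div_eq_iff (pow_ne_zero _ ht), ← pow_add, Nat.sub_add_cancel hk]
  rw [h1, Polynomial.eval_eq_sum_range' hd, Finset.mul_sum, ← Fin.sum_univ_eq_sum_range
    (fun i => ((t : ℂ) ^ K)⁻¹ * ((q a).coeff i * (t : ℂ) ^ i))]
  refine Finset.sum_congr rfl fun j _ => ?_
  rw [zpow_sub₀ ht, zpow_natCast, zpow_natCast]
  field_simp

end IsLaurent

/-! ### Functional calculus for complete orthogonal idempotents -/

section Idempotents

variable {n : ℕ} {ι : Type*} [Fintype ι]

lemma sum_smul_mul_sum_smul {R : Type*} [Ring R] [Algebra ℂ R] {P : ι → R}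
    (hP : OrthogonalIdempotents P) (a b : ι → ℂ) :
    (∑ j, a j • P j) * (∑ j, b j • P j) = ∑ j, (a j * b j) • P j := by
  classical
  simp [Finset.sum_mul, Finset.mul_sum, hP.mul_eq, smul_smul, mul_comm]

lemma mul_sum_smul {R : Type*} [Ring R] [Algebra ℂ R] {P : ι → R}
    (hP : OrthogonalIdempotents P) (a : ι → ℂ) (i : ι) :
    P i * (∑ j, a j • P j) = a i • P i := by
  classical
  simp [Finset.mul_sum, hP.mul_eq]

lemma sum_smul_pow {R : Type*} [Ring R] [Algebra ℂ R] {P : ι → R}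
    (hP : CompleteOrthogonalIdempotents P) (a : ι → ℂ) (k : ℕ) :
    (∑ j, a j • P j) ^ k = ∑ j, (a j ^ k) • P j := by
  induction k with
  | zero => simp [hP.complete]
  | succ k ih => rw [pow_succ, ih, sum_smul_mul_sum_smul hP.1]; simp [pow_succ]

open scoped Matrix.Norms.L2Operator in
-- The map `c ↦ ∑ c j • P j` is a continuous ring homomorphism from `ℂ^ι`, where the exponential is
-- taken coordinatewise.
lemma exp_sum_smul {P : ι → Matrix (Fin n) (Fin n) ℂ}
    (hP : CompleteOrthogonalIdempotents P) (c : ι → ℂ) :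
    NormedSpace.exp (∑ j, c j • P j) = ∑ j, Complex.exp (c j) • P j := by
  let f : (ι → ℂ) →+* Matrix (Fin n) (Fin n) ℂ :=
    { toFun := fun c => ∑ j, c j • P j
      map_zero' := by simp
      map_one' := by simp [hP.complete]
      map_add' := fun a b => by simp [add_smul, Finset.sum_add_distrib]
      map_mul' := fun a b => (sum_smul_mul_sum_smul hP.1 a b).symm }
  have hf : Continuous f := by
    change Continuous fun c : ι → ℂ => ∑ j, c j • P j
    fun_prop
  have h := NormedSpace.map_exp f hf c
  rw [Pi.exp_def] at h
  simp only [← Complex.exp_eq_exp_ℂ] at h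
  exact h.symm

/-- The spectral theorem, in terms of orthogonal projections. -/
lemma exists_spectral_projections {M : Matrix (Fin n) (Fin n) ℂ} (hM : M.IsHermitian) :
    ∃ P : Fin n → Matrix (Fin n) (Fin n) ℂ, CompleteOrthogonalIdempotents P ∧
      (∀ j, star (P j) = P j) ∧ M = ∑ j, (hM.eigenvalues j : ℂ) • P j := by
  let U := hM.eigenvectorUnitary
  let f := Unitary.conjStarAlgAut ℂ (Matrix (Fin n) (Fin n) ℂ) U
  let D : Fin n → Matrix (Fin n) (Fin n) ℂ := fun j => Matrix.diagonal (Pi.single j 1)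
  have hD : CompleteOrthogonalIdempotents D :=
    (CompleteOrthogonalIdempotents.single (fun _ : Fin n => ℂ)).map
      (Matrix.diagonalRingHom (Fin n) ℂ)
  refine ⟨fun j => f (D j), hD.map (f : Matrix (Fin n) (Fin n) ℂ ≃+* Matrix (Fin n) (Fin n) ℂ).toRingHom, fun j => ?_, ?_⟩
  · rw [← map_star]
    congr 1
    rw [Matrix.star_eq_conjTranspose, Matrix.diagonal_conjTranspose]
    congr 1
    ext i
    by_cases h : i = j <;> simp [h]
  · conv_lhs => rw [hM.spectral_theorem]
    change f _ = _
    rw [show Matrix.diagonal (RCLike.ofReal ∘ hM.eigenvalues) =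
      ∑ j, ((hM.eigenvalues j : ℂ)) • D j from ?_]
    · rw [map_sum]
      simp only [map_smul]
    · ext a b
      simp only [Matrix.sum_apply, Matrix.smul_apply, D, Matrix.diagonal_apply]
      by_cases h : a = b <;> simp [h, Pi.single_apply]

/-- The homomorphism `t ↦ ∑ j, t ^ w j • P j` attached to complete orthogonal idempotents `P` and
integral weights `w`. -/
def toricHom {P : ι → Matrix (Fin n) (Fin n) ℂ} (hP : CompleteOrthogonalIdempotents P)
    (w : ι → ℤ) : ℂˣ →* GL (Fin n) ℂ :=
  MonoidHom.toHomUnits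
    { toFun := fun t => ∑ j, ((t : ℂ) ^ w j) • P j
      map_one' := by simp [hP.complete]
      map_mul' := fun s t => by simp [sum_smul_mul_sum_smul hP.1, mul_zpow] }

lemma coe_toricHom {P : ι → Matrix (Fin n) (Fin n) ℂ} (hP : CompleteOrthogonalIdempotents P)
    (w : ι → ℤ) (t : ℂˣ) :
    (toricHom hP w t : Matrix (Fin n) (Fin n) ℂ) = ∑ j, ((t : ℂ) ^ w j) • P j := rfl

/-- Matrix form of `eval_eq_zero_of_characters`. -/
lemma eval_matrix_eq_zero_of_characters {Γ M : Type*} [AddCommMonoid Γ] [Monoid M]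
    (χ : Multiplicative Γ →* (M →* ℂ)) (hχ : Function.Injective χ) (ψ : Multiplicative Γ →* ℂ)
    (P : ι → Matrix (Fin n) (Fin n) ℂ) (d : ι → Γ) (p : MvPolynomial (Fin n × Fin n) ℂ)
    (h : ∀ x, MvPolynomial.eval
      (fun ij => (∑ j, χ (.ofAdd (d j)) x • P j) ij.1 ij.2) p = 0) :
    MvPolynomial.eval (fun ij => (∑ j, ψ (.ofAdd (d j)) • P j) ij.1 ij.2) p = 0 := by
  have := eval_eq_zero_of_characters χ hχ ψ (fun j ij => P j ij.1 ij.2) d p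
    (fun x => by simpa [Matrix.sum_apply] using h x)
  simpa [Matrix.sum_apply] using this

open scoped ComplexOrder in
/-- A positive definite matrix `h` has a Hermitian logarithm `Z`, and a polynomial that vanishes on
the powers of `h` vanishes on all `exp (rZ)`. -/
lemma exists_log_of_posDef {h : Matrix (Fin n) (Fin n) ℂ} (hh : h.PosDef) :
    ∃ Z : Matrix (Fin n) (Fin n) ℂ, star Z = Z ∧ NormedSpace.exp Z = h ∧
      ∀ p : MvPolynomial (Fin n × Fin n) ℂ,
        (∀ k : ℕ, MvPolynomial.eval (fun ij => (h ^ k) ij.1 ij.2) p = 0) →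
        ∀ r : ℝ, MvPolynomial.eval (fun ij => (NormedSpace.exp (r • Z)) ij.1 ij.2) p = 0 := by
  obtain ⟨P, hP, hs, hM⟩ := exists_spectral_projections hh.1
  have hpos := hh.eigenvalues_pos
  set θ := hh.1.eigenvalues
  have hexp : ∀ r : ℝ, NormedSpace.exp (r • ∑ j, ((Real.log (θ j) : ℝ) : ℂ) • P j) =
      ∑ j, Complex.exp (r * (Real.log (θ j) : ℝ)) • P j := by
    intro r
    rw [← exp_sum_smul hP, Finset.smul_sum]
    congr 1
    refine Finset.sum_congr rfl fun j _ => ?_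
    rw [← Complex.coe_smul r, smul_smul]
  have hθ : ∀ j, Complex.exp ((Real.log (θ j) : ℝ)) = θ j := fun j => by
    rw [← Complex.ofReal_exp, Real.exp_log (hpos j)]
  refine ⟨∑ j, ((Real.log (θ j) : ℝ) : ℂ) • P j, ?_, ?_, fun p hp r => ?_⟩
  · simp [star_sum, star_smul, hs]
  · rw [exp_sum_smul hP, hM]
    simp [hθ]
  -- The entries of `h ^ k` are combinations of the characters `k ↦ exp (kγ)` of `ℕ`, with `γ = log
  -- θ_j`; distinct `γ` already differ at `k = 1`. Replacing the integer `k` by the real `r` is the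
  -- character `ψ`.
  · let χ : Multiplicative ℝ →* (Multiplicative ℕ →* ℂ) :=
      { toFun := fun γ =>
          { toFun := fun k => Complex.exp ((k.toAdd : ℂ) * (γ.toAdd : ℂ))
            map_one' := by simp
            map_mul' := fun a b => by rw [← Complex.exp_add]; simp [add_mul] }
        map_one' := by ext; simp
        map_mul' := fun a b => by ext; simp [← Complex.exp_add, mul_add] }
    let ψ : Multiplicative ℝ →* ℂ :=
      { toFun := fun γ => Complex.exp ((r : ℂ) * (γ.toAdd : ℂ))
        map_one' := by simp
        map_mul' := fun a b => by rw [← Complex.exp_add]; simp [mul_add] }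
    have hχ : Function.Injective χ := by
      intro a b hab
      have h1 : Complex.exp (((1 : ℕ) : ℂ) * (a.toAdd : ℂ)) =
          Complex.exp (((1 : ℕ) : ℂ) * (b.toAdd : ℂ)) :=
        DFunLike.congr_fun hab (Multiplicative.ofAdd 1)
      rw [Nat.cast_one, one_mul, one_mul, ← Complex.ofReal_exp, ← Complex.ofReal_exp] at h1
      exact Multiplicative.toAdd.injective (Real.exp_injective (Complex.ofReal_injective h1))
    rw [hexp]
    refine eval_matrix_eq_zero_of_characters χ hχ ψ P (fun j => Real.log (θ j)) p fun k => ?_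
    rw [← hp k.toAdd]
    congr 2
    ext ij
    rw [hM, sum_smul_pow hP]
    simp only [χ, MonoidHom.coe_mk, OneHom.coe_mk, toAdd_ofAdd, Complex.exp_nat_mul, hθ]

open scoped ComplexOrder in
-- The scalar inequality `1 + θ ≤ e^θ` on each eigenvalue. It turns an upper bound on `exp Z` into
-- one on `Z`, and it survives compression.
lemma posSemidef_exp_sub {Z : Matrix (Fin n) (Fin n) ℂ} (hZ : star Z = Z) :
    (NormedSpace.exp Z - 1 - Z).PosSemidef := by
  obtain ⟨P, hP, hs, hM⟩ := exists_spectral_projections (M := Z) hZ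
  set θ := Matrix.IsHermitian.eigenvalues (A := Z) hZ
  have : NormedSpace.exp Z - 1 - Z =
      ∑ j, ((Real.exp (θ j) - 1 - θ j : ℝ) : ℂ) • (star (P j) * P j) := by
    rw [hM, exp_sum_smul hP, ← hP.complete, ← Finset.sum_sub_distrib, ← Finset.sum_sub_distrib]
    refine Finset.sum_congr rfl fun j _ => ?_
    rw [hs, (hP.idem j).eq]
    push_cast
    module
  rw [this]
  refine Matrix.posSemidef_sum _ fun j _ => ?_
  refine (Matrix.posSemidef_conjTranspose_mul_self (P j)).smul ?_
  have := Real.add_one_le_exp (θ j)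
  exact_mod_cast (by linarith : (0 : ℝ) ≤ Real.exp (θ j) - 1 - θ j)

end Idempotents

section Exponential

variable {n : ℕ}

open scoped Matrix.Norms.L2Operator in
lemma eq_of_exp_smul_eq {X Y : Matrix (Fin n) (Fin n) ℂ}
    (h : ∀ t : ℝ, NormedSpace.exp (t • X) = NormedSpace.exp (t • Y)) : X = Y := by
  have e : ∀ Z : Matrix (Fin n) (Fin n) ℂ,
      HasDerivAt (fun t : ℝ => NormedSpace.exp (t • Z)) Z 0 := fun Z => by
    simpa using hasDerivAt_exp_smul_const (𝕂 := ℝ) Z (0 : ℝ)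
  have h1 := e X
  rw [funext h] at h1
  exact h1.unique (e Y)

lemma star_exp_smul {Z : Matrix (Fin n) (Fin n) ℂ} (hZ : star Z = Z) (r : ℝ) :
    star (NormedSpace.exp (r • Z)) = NormedSpace.exp (r • Z) := by
  rw [Matrix.star_eq_conjTranspose, ← Matrix.exp_conjTranspose, ← Matrix.star_eq_conjTranspose,
    star_smul, hZ, star_trivial]

lemma expGL_add_smul (Z : Matrix (Fin n) (Fin n) ℂ) (r s : ℝ) :
    expGL ((r + s) • Z) = expGL (r • Z) * expGL (s • Z) := by
  refine Units.ext ?_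
  rw [Units.val_mul, coe_expGL, coe_expGL, coe_expGL, add_smul,
    Matrix.exp_add_of_commute _ _ (((Commute.refl Z).smul_left r).smul_right s)]

end Exponential

/-! ### Polar decomposition inside `G` -/

namespace ComplexReductiveGroup

variable {n : ℕ} (G : ComplexReductiveGroup n)

lemma mem_of_tendsto {κ : Type*} {F : Filter κ} [F.NeBot] {u : κ → GL (Fin n) ℂ}
    {g : GL (Fin n) ℂ} (hu : ∀ m, u m ∈ G.toSubgroup)
    (h : Tendsto (fun m => (u m : Matrix (Fin n) (Fin n) ℂ)) F (𝓝 (g : Matrix _ _ ℂ))) :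
    g ∈ G.toSubgroup := by
  obtain ⟨S, hS⟩ := G.zariski_closed
  refine (hS g).2 fun p hp => ?_
  have hc : Continuous fun M : Matrix (Fin n) (Fin n) ℂ =>
      MvPolynomial.eval (fun ij : Fin n × Fin n => M ij.1 ij.2) p :=
    (MvPolynomial.continuous_eval p).comp (by fun_prop)
  refine tendsto_nhds_unique ((hc.tendsto _).comp h) ?_
  refine tendsto_const_nhds.congr fun m => ?_
  exact (((hS (u m)).1 (hu m)) p hp).symm

open scoped ComplexOrder in
/-- A positive definite element of `G` has a Hermitian logarithm that generates a one-parameter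
group of elements of `G`. -/
lemma exists_log_mem {h : GL (Fin n) ℂ} (hG : h ∈ G.toSubgroup)
    (hh : (h : Matrix (Fin n) (Fin n) ℂ).PosDef) :
    ∃ Z : Matrix (Fin n) (Fin n) ℂ, star Z = Z ∧ NormedSpace.exp Z = h ∧
      (∀ r : ℝ, expGL (r • Z) ∈ G.toSubgroup) ∧
      ∀ X, Commute (h : Matrix (Fin n) (Fin n) ℂ) X →
        ∀ r : ℝ, Commute (NormedSpace.exp (r • Z)) X := by
  obtain ⟨Z, hZ, hexp, hp⟩ := exists_log_of_posDef hh
  obtain ⟨S, hS⟩ := G.zariski_closed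
  refine ⟨Z, hZ, hexp, fun r => (hS _).2 fun p hpS => hp p (fun k => ?_) r, fun X hX r => ?_⟩
  · simpa using (hS (h ^ k)).1 (pow_mem hG k) p hpS
  -- Commuting with `X` is a system of polynomial equations, so it passes from the powers of `h` to
  -- `exp (rZ)`.
  · have key : ∀ (M : Matrix (Fin n) (Fin n) ℂ) (i j : Fin n),
        MvPolynomial.eval (fun ij => M ij.1 ij.2)
          (∑ l, (MvPolynomial.X (i, l) * MvPolynomial.C (X l j) -
            MvPolynomial.C (X i l) * MvPolynomial.X (l, j))) = (M * X - X * M) i j := by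
      intro M i j
      simp [Matrix.mul_apply, Finset.sum_sub_distrib]
    refine sub_eq_zero.1 (Matrix.ext fun i j => ?_)
    rw [← key, Matrix.zero_apply]
    refine hp _ (fun k => ?_) r
    rw [key, sub_eq_zero.2 (hX.pow_left k).eq, Matrix.zero_apply]

lemma star_lieK (α : G.lieK) : star (α : Matrix (Fin n) (Fin n) ℂ) = -α :=
  star_eq_neg_of_exp_unitary fun s => (α.2 s).2

open scoped ComplexOrder in
lemma posDef_star_mul_self (g : GL (Fin n) ℂ) :
    ((star g * g : GL (Fin n) ℂ) : Matrix (Fin n) (Fin n) ℂ).PosDef := by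
  rw [Units.val_mul, Units.coe_star, Matrix.star_eq_conjTranspose]
  exact Matrix.PosDef.conjTranspose_mul_self _
    (Matrix.mulVec_injective_of_isUnit g.isUnit)

variable {G}

/-- Elements of `𝔨` that are conjugate under `G` have the same norm. -/
lemma InvariantInnerProduct.norm_eq_of_conj (B : G.InvariantInnerProduct) {α α' : G.lieK}
    (g : G.toSubgroup) (h : ∀ t : ℝ, g * G.exp α t * g⁻¹ = G.exp α' t) :
    B.norm α = B.norm α' := by
  obtain ⟨g, hg⟩ := g
  have hα' : (α' : Matrix (Fin n) (Fin n) ℂ) = g.val * α.val * (g⁻¹).val := by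
    refine eq_of_exp_smul_eq fun t => ?_
    have h1 := congrArg (fun x : G.toSubgroup => (x : GL (Fin n) ℂ).val) (h t)
    rw [← smul_mul_assoc, ← mul_smul_comm, Matrix.exp_units_conj]
    exact h1.symm
  obtain ⟨Z, hZ, hexp, hmem, hcomm⟩ := G.exists_log_mem
    (mul_mem (G.star_mem g hg) hg) (posDef_star_mul_self g)
  have hgα : α'.val * g.val = g.val * α.val := by
    rw [hα', mul_assoc, Units.inv_mul, mul_one]
  -- Adjoint of `α' g = g α`: since `α` and `α'` are skew-Hermitian, `g^* α' = α g^*`, and therefore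
  -- `g^* g α = g^* α' g = α g^* g`.
  have hc : Commute ((star g * g : GL (Fin n) ℂ) : Matrix (Fin n) (Fin n) ℂ) α.val := by
    have h1 := congrArg star hgα
    rw [star_mul, star_mul, G.star_lieK, G.star_lieK] at h1
    rw [Commute, SemiconjBy, Units.val_mul, Units.coe_star, mul_assoc, ← hgα, ← mul_assoc,
      ← mul_assoc]
    congr 1
    simpa using h1
  have hp := hcomm _ hc 2⁻¹
  set p : GL (Fin n) ℂ := expGL ((2⁻¹ : ℝ) • Z) with hpdef
  have hpp : p * p = star g * g := by
    refine Units.ext ?_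
    rw [hpdef, ← expGL_add_smul, coe_expGL, ← hexp]
    norm_num
  have hps : star p = p := Units.ext (star_exp_smul hZ _)
  -- With `p` the positive square root of `g^* g`, this is the unitary factor of `g`. As `p`
  -- commutes with `α`, it conjugates `α` to `α'` just as `g` does, and `B` is invariant under it.
  have hk : g * p⁻¹ ∈ G.compactForm := by
    refine ⟨mul_mem hg (inv_mem (hmem _)), ?_⟩
    have : star (g * p⁻¹) * (g * p⁻¹) = 1 := by
      rw [star_mul, star_inv, hps, mul_assoc, ← mul_assoc (star g), ← hpp]
      group
    simpa using congrArg Units.val this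
  have hAd : α' = G.Ad ⟨g * p⁻¹, hk⟩ α := by
    refine Subtype.ext ?_
    change α'.val = (g * p⁻¹ : GL (Fin n) ℂ).val * α.val * ((g * p⁻¹ : GL (Fin n) ℂ)⁻¹).val
    have h2 : (p⁻¹).val * α.val = α.val * (p⁻¹).val :=
      (Commute.units_inv_left (u := p) hp).eq
    rw [hα', mul_inv_rev, inv_inv, Units.val_mul, Units.val_mul, mul_assoc g.val (p⁻¹).val, h2]
    simp only [mul_assoc]
    rw [← mul_assoc (p⁻¹).val, Units.inv_mul, one_mul]
  unfold norm
  rw [hAd, B.invariant]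

/-! ### One-parameter subgroups given by idempotents and weights -/

section Toric

variable {ι : Type*} [Fintype ι] {P : ι → Matrix (Fin n) (Fin n) ℂ}

variable (G) in
/-- The one-parameter subgroup `t ↦ ∑ j, t ^ w j • P j`. -/
def toricOnePS (hP : CompleteOrthogonalIdempotents P) (w : ι → ℤ)
    (hmem : ∀ t, toricHom hP w t ∈ G.toSubgroup) (hne : ∃ t, toricHom hP w t ≠ 1) : G.OnePS where
  toHom := (toricHom hP w).codRestrict G.toSubgroup hmem
  regular i j := by
    have : IsLaurent fun t => ∑ a, (t : ℂ) ^ w a * P a i j :=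
      .sum fun a => (IsLaurent.zpow _).mul (.const _)
    obtain ⟨p, k, h⟩ := this
    refine ⟨p, k, fun t => ?_⟩
    rw [← h]
    simp [coe_toricHom, Matrix.sum_apply]
  nontrivial := by
    obtain ⟨t, ht⟩ := hne
    exact ⟨t, fun h => ht (congrArg Subtype.val h)⟩

/-- The infinitesimal generator `∑ j, 2πi w j • P j` of `t ↦ ∑ j, t ^ w j • P j`. -/
def toricWeight (P : ι → Matrix (Fin n) (Fin n) ℂ) (w : ι → ℤ) : Matrix (Fin n) (Fin n) ℂ :=
  ∑ j, (2 * Real.pi * Complex.I * w j) • P j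

lemma expGL_toricWeight (hP : CompleteOrthogonalIdempotents P) (w : ι → ℤ) (t : ℝ) :
    expGL (t • toricWeight P w) =
      toricHom hP w (Circle.toUnits (Circle.exp (2 * Real.pi * t))) := by
  refine Units.ext ?_
  rw [coe_expGL, coe_toricHom, toricWeight, Finset.smul_sum]
  simp only [← Complex.coe_smul t, smul_smul]
  rw [exp_sum_smul hP]
  refine Finset.sum_congr rfl fun j _ => ?_
  congr 1
  rw [Circle.toUnits_apply, Units.val_mk0, Circle.coe_exp, ← Complex.exp_int_mul]
  congr 1
  push_cast
  ring

lemma toricWeight_mem_lieK (hP : CompleteOrthogonalIdempotents P) (hs : ∀ j, star (P j) = P j)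
    (w : ι → ℤ) (hmem : ∀ t, toricHom hP w t ∈ G.toSubgroup) : toricWeight P w ∈ G.lieK := by
  intro t
  refine ⟨?_, exp_unitary_of_star_eq_neg ?_ t⟩
  · rw [expGL_toricWeight hP]
    exact hmem _
  · rw [toricWeight, star_sum, ← Finset.sum_neg_distrib]
    refine Finset.sum_congr rfl fun j _ => ?_
    rw [star_smul, hs, ← neg_smul]
    congr 1
    simp

end Toric

end ComplexReductiveGroup

/-! ### From a grading to an orthogonal grading with the same filtration -/

section Orthogonalization

variable {n : ℕ}

/-- The orthogonal projection onto the range of an idempotent matrix. -/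
lemma exists_orthogonal_projection (e : Matrix (Fin n) (Fin n) ℂ) (he : e * e = e) :
    ∃ π : Matrix (Fin n) (Fin n) ℂ, star π = π ∧ π * e = e ∧ e * π = π := by
  let Φ := Matrix.toEuclideanCLM (n := Fin n) (𝕜 := ℂ)
  let W := (Φ e).range
  have hs : star W.starProjection = W.starProjection := isSelfAdjoint_starProjection W
  obtain ⟨π, hπ⟩ := Φ.surjective W.starProjection
  change Φ π = _ at hπ
  have hinj : Function.Injective Φ := Φ.injective
  refine ⟨π, hinj ?_, hinj ?_, hinj ?_⟩
  · rw [map_star, hπ, hs]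
  · rw [map_mul, hπ]
    ext1 x
    exact Submodule.starProjection_eq_self_iff.2 ⟨x, rfl⟩
  · rw [map_mul, hπ]
    ext1 x
    obtain ⟨y, hy⟩ := W.starProjection_apply_mem x
    change Φ e y = _ at hy
    change Φ e (W.starProjection x) = _
    rw [← hy, ← mul_apply_eq_comp, ← map_mul, he]

/-- Orthogonalization of the filtration defined by complete orthogonal idempotents. -/
lemma exists_orthogonalization {N : ℕ} {E : Fin (N + 1) → Matrix (Fin n) (Fin n) ℂ}
    (hE : CompleteOrthogonalIdempotents E) :
    ∃ Q : Fin (N + 1) → Matrix (Fin n) (Fin n) ℂ, CompleteOrthogonalIdempotents Q ∧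
      (∀ j, star (Q j) = Q j) ∧ (∀ i j, i < j → Q i * E j = 0) ∧ (∀ i j, i < j → E i * Q j = 0) ∧
      ∀ i, E i * Q i * E i = E i := by
  -- `e i` projects onto the pieces with index at least `i`; its ranges form a decreasing filtration
  -- from `e 0 = 1` to `e (N + 1) = 0`.
  let e : ℕ → Matrix (Fin n) (Fin n) ℂ :=
    fun i => ∑ j ∈ Finset.univ.filter (fun j : Fin (N + 1) => i ≤ j), E j
  have heE : ∀ i (j : Fin (N + 1)), e i * E j = if i ≤ j then E j else 0 := by
    intro i j
    simp [e, Finset.sum_mul, hE.mul_eq]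
  have hEe : ∀ i (j : Fin (N + 1)), E j * e i = if i ≤ j then E j else 0 := by
    intro i j
    simp [e, Finset.mul_sum, hE.mul_eq]
  have hee : ∀ i l, i ≤ l → e i * e l = e l := by
    intro i l hil
    conv_lhs => rw [show e l = ∑ j ∈ Finset.univ.filter (fun j : Fin (N + 1) => l ≤ j), E j from rfl,
      Finset.mul_sum]
    refine Finset.sum_congr rfl fun j hj => ?_
    rw [heE, if_pos (hil.trans (Finset.mem_filter.1 hj).2)]
  -- Orthogonal projections onto the same ranges. Their successive differences are the `Q j`, as in
  -- Gram-Schmidt.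
  choose π hs hπe heπ using fun i => exists_orthogonal_projection (e i) (hee i i le_rfl)
  have hπe' : ∀ i l, i ≤ l → π i * e l = e l := by
    intro i l hil
    rw [← hee i l hil, ← mul_assoc, hπe]
  have heπ' : ∀ i l, i ≤ l → e i * π l = π l := by
    intro i l hil
    rw [← heπ l, ← mul_assoc, hee i l hil]
  have hππ : ∀ i l, i ≤ l → π i * π l = π l := by
    intro i l hil
    rw [← heπ l, ← mul_assoc, hπe' i l hil]
  have hππ' : ∀ i l, i ≤ l → π l * π i = π l := by
    intro i l hil
    have := congrArg star (hππ i l hil)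
    rwa [star_mul, hs, hs] at this
  have hπ0 : π 0 = 1 := by
    have : e 0 = 1 := by simp [e, hE.complete]
    rw [← mul_one (π 0), ← this, hπe]
  have hπN : π (N + 1) = 0 := by
    have : e (N + 1) = 0 := by
      simp only [e]
      rw [Finset.filter_false_of_mem, Finset.sum_empty]
      intro j _
      have := j.2
      omega
    rw [← heπ, this, zero_mul]
  have hQE : ∀ i j : Fin (N + 1), i < j → (π i - π (i + 1)) * E j = 0 := by
    intro i j hij
    have hij' : (i : ℕ) + 1 ≤ j := hij
    have h1 : E j = e j * E j := by rw [heE, if_pos le_rfl]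
    rw [h1, ← mul_assoc, sub_mul, hπe' _ _ hij', hπe' _ _ (by omega), sub_self, zero_mul]
  have hEQ : ∀ i j : Fin (N + 1), i < j → E i * (π j - π (j + 1)) = 0 := by
    intro i j hij
    have hij' : ¬ (j : ℕ) ≤ i := not_le.2 hij
    rw [show π j - π (j + 1) = e j * (π j - π (j + 1)) by
      rw [mul_sub, heπ' _ _ le_rfl, heπ' _ _ (Nat.le_succ _)], ← mul_assoc, hEe, if_neg hij',
      zero_mul]
  refine ⟨fun j => π j - π (j + 1), CompleteOrthogonalIdempotents.iff_ortho_complete.2 ⟨?_, ?_⟩,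
    fun j => by rw [star_sub, hs, hs], hQE, hEQ, fun i => ?_⟩
  · intro i j hij
    change (π i - π (i + 1)) * (π j - π (j + 1)) = 0
    rcases lt_or_gt_of_ne hij with h | h
    · have h' : (i : ℕ) + 1 ≤ j := h
      rw [sub_mul, mul_sub, mul_sub, hππ _ _ (by omega), hππ _ _ (by omega), hππ _ _ (by omega),
        hππ _ _ (by omega)]
      abel
    · have h' : (j : ℕ) + 1 ≤ i := h
      rw [sub_mul, mul_sub, mul_sub, hππ' _ _ (by omega), hππ' _ _ (by omega),
        hππ' _ _ (by omega), hππ' _ _ (by omega)]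
      abel
  · rw [Fin.sum_univ_eq_sum_range (fun j => π j - π (j + 1)), Finset.sum_range_sub', hπ0, hπN,
      sub_zero]
  -- `π i` fixes the range of `E i`, and `E i` kills that of `π (i + 1)`. This identity later
  -- provides the inverse of the conjugating element.
  · have h1 : π i * E i = E i := by
      have h1 : E i = e i * E i := by rw [heE, if_pos le_rfl]
      rw [h1, ← mul_assoc, hπe]
    have h2 : E i * π (i + 1) = 0 := by
      rw [← heπ, ← mul_assoc, hEe, if_neg (by omega), zero_mul]
    rw [mul_sub, sub_mul, h2, zero_mul, sub_zero, mul_assoc, h1, (hE.idem i).eq]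

end Orthogonalization

/-! ### Operator inequalities and their limits -/

section Limits

variable {n : ℕ}

open scoped ComplexOrder

lemma isClosed_posSemidef : IsClosed {M : Matrix (Fin n) (Fin n) ℂ | M.PosSemidef} := by
  have h : {M : Matrix (Fin n) (Fin n) ℂ | M.PosSemidef} =
      {M | star M = M} ∩ ⋂ x : Fin n → ℂ, {M | 0 ≤ star x ⬝ᵥ M.mulVec x} := by
    ext M
    simp only [Set.mem_ofPred_eq, Set.mem_inter_iff, Set.mem_iInter]
    exact ⟨fun h => ⟨h.1, fun x => h.dotProduct_mulVec_nonneg x⟩,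
      fun h => .of_dotProduct_mulVec_nonneg h.1 h.2⟩
  rw [h]
  refine (isClosed_eq (by fun_prop) (by fun_prop)).inter (isClosed_iInter fun x => ?_)
  exact isClosed_le continuous_const (by fun_prop)

/-- The estimate `1 + Z ≤ exp Z`, compressed by `T`. -/
lemma posSemidef_compression {A M T : Matrix (Fin n) (Fin n) ℂ} {s m : ℝ} (hs : 0 < s)
    (hA : star A = A) (hexp : NormedSpace.exp ((2 : ℝ) • A) = star M * M) (hT : star T = T) :
    ((2 * s)⁻¹ • (star (Real.exp (-(s * m)) • (M * T)) * (Real.exp (-(s * m)) • (M * T)) - T * T) +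
      T * (m • 1 - s⁻¹ • A) * T).PosSemidef := by
  -- The shift by `2sm` normalizes `exp (2A)` by `e^{-2sm}`, which is split evenly between `M` and
  -- `star M`; the inequality is then divided by `2s`.
  set Z : Matrix (Fin n) (Fin n) ℂ := (2 : ℝ) • A - (2 * s * m) • 1 with hZ
  have hZs : star Z = Z := by simp [hZ, hA]
  have hZe : NormedSpace.exp Z = Real.exp (-(2 * s * m)) • (star M * M) := by
    rw [hZ, sub_eq_add_neg, ← neg_smul, Matrix.exp_add_of_commute _ _
      ((Commute.one_right _).smul_right _), hexp, ← Algebra.algebraMap_eq_smul_one]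
    rw [show NormedSpace.exp ((algebraMap ℝ (Matrix (Fin n) (Fin n) ℂ)) (-(2 * s * m))) =
      algebraMap ℝ (Matrix (Fin n) (Fin n) ℂ) (Real.exp (-(2 * s * m))) from ?_]
    · rw [← Algebra.commutes, Algebra.smul_def]
    · open scoped Matrix.Norms.L2Operator in
      rw [Real.exp_eq_exp_ℝ]
      exact (NormedSpace.algebraMap_exp_comm _).symm
  have h1 := (posSemidef_exp_sub hZs).conjTranspose_mul_mul_same T
  rw [← Matrix.star_eq_conjTranspose, hT, hZe] at h1
  have h2 := h1.smul (a := (2 * s)⁻¹) (by positivity)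
  convert h2 using 1
  have he : Real.exp (-(2 * s * m)) = Real.exp (-(s * m)) * Real.exp (-(s * m)) := by
    rw [← Real.exp_add]; ring_nf
  rw [he, hZ, star_smul, star_mul, hT]
  simp only [mul_sub, sub_mul, smul_sub, mul_smul_comm, smul_mul_assoc, smul_smul, mul_one,
    star_trivial, mul_assoc]
  have e1 : (2 * s)⁻¹ * 2 = s⁻¹ := by field_simp
  have e2 : (2 * s)⁻¹ * (2 * (s * m)) = m := by field_simp
  rw [e1, e2]
  abel

/-- In `posSemidef_compression` the first term is `(2s)⁻¹` times a convergent expression, so it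
disappears in the limit. -/
lemma posSemidef_of_tendsto {κ : Type*} {F : Filter κ} [F.NeBot] {s : κ → ℝ} {m : ℝ}
    {A M : κ → Matrix (Fin n) (Fin n) ℂ} {T D X : Matrix (Fin n) (Fin n) ℂ}
    (hs : Tendsto s F atTop) (hA : ∀ k, star (A k) = A k)
    (hexp : ∀ k, NormedSpace.exp ((2 : ℝ) • A k) = star (M k) * M k) (hT : star T = T)
    (hD : Tendsto (fun k => Real.exp (-(s k * m)) • (M k * T)) F (𝓝 D))
    (hX : Tendsto (fun k => (s k)⁻¹ • A k) F (𝓝 X)) :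
    (T * (m • 1 - X) * T).PosSemidef := by
  have h0 : Tendsto (fun k => (2 * s k)⁻¹) F (𝓝 0) :=
    tendsto_inv_atTop_zero.comp (hs.const_mul_atTop two_pos)
  have hDs : Tendsto (fun k => star (Real.exp (-(s k * m)) • (M k * T))) F (𝓝 (star D)) :=
    (continuous_star.tendsto D).comp hD
  have h1 := (h0.smul ((hDs.mul hD).sub_const (T * T))).add
    (((hX.const_sub (m • 1)).const_mul T).mul_const T)
  rw [zero_smul, zero_add] at h1
  refine isClosed_posSemidef.mem_of_tendsto h1 ?_
  filter_upwards [hs.eventually_gt_atTop 0] with k hk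
  exact posSemidef_compression hk (hA k) (hexp k) hT

/-- Every non-zero term either decays or is constant. -/
lemma exists_tendsto_sum_exp_smul {ι : Type*} [Fintype ι] {c : ι → ℝ}
    {F : ι → Matrix (Fin n) (Fin n) ℂ} (h : ∀ j, F j ≠ 0 → c j ≤ 0) :
    ∃ D, Tendsto (fun s : ℝ => ∑ j, Real.exp (s * c j) • F j) atTop (𝓝 D) := by
  have : ∀ j, ∃ D, Tendsto (fun s : ℝ => Real.exp (s * c j) • F j) atTop (𝓝 D) := by
    intro j
    by_cases hF : F j = 0
    · exact ⟨0, by simp [hF]⟩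
    · rcases (h j hF).lt_or_eq with hc | hc
      · refine ⟨(0 : ℝ) • F j, Tendsto.smul_const ?_ _⟩
        exact Real.tendsto_exp_atBot.comp (tendsto_id.atTop_mul_const_of_neg hc)
      · exact ⟨F j, by simp [hc]⟩
  choose D hD using this
  exact ⟨∑ j, D j, tendsto_finsetSum _ fun j _ => hD j⟩

open scoped MatrixOrder Matrix.Norms.L2Operator in
-- With `N = R^* R` the hypothesis reads `(RQ)^* (RQ) = 0`, so `RQ = 0`.
lemma mul_eq_zero_of_posSemidef {N Q : Matrix (Fin n) (Fin n) ℂ}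
    (hN : N.PosSemidef) (h : star Q * N * Q = 0) : N * Q = 0 := by
  obtain ⟨R, rfl⟩ := CStarAlgebra.nonneg_iff_eq_star_mul_self.mp hN.nonneg
  have : (R * Q).conjTranspose * (R * Q) = 0 := by
    rw [Matrix.conjTranspose_mul, ← h, Matrix.star_eq_conjTranspose, Matrix.star_eq_conjTranspose]
    simp only [mul_assoc]
  rw [mul_assoc, Matrix.conjTranspose_mul_self_eq_zero.1 this, mul_zero]

open scoped MatrixOrder Matrix.Norms.L2Operator in
-- The norm is monotone on `0 ≤ D + X ≤ C + D`.
lemma norm_le_of_posSemidef_of_posSemidef {X C D : Matrix (Fin n) (Fin n) ℂ}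
    (h₁ : (C - X).PosSemidef) (h₂ : (D + X).PosSemidef) : ‖X‖ ≤ ‖C + D‖ + ‖D‖ := by
  have h := CStarAlgebra.norm_le_norm_of_nonneg_of_le (a := D + X) (b := C + D)
    (Matrix.nonneg_iff_posSemidef.2 h₂) (Matrix.le_iff.2 (by rwa [show C + D - (D + X) = C - X by abel]))
  calc ‖X‖ = ‖(D + X) - D‖ := by congr 1; abel
    _ ≤ ‖D + X‖ + ‖D‖ := norm_sub_le _ _
    _ ≤ _ := by gcongr

end Limits

/-! ### Asymptotics of the polar part along a one-parameter subgroup -/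

section Ray

open scoped ComplexOrder

variable {n N : ℕ}

/-- The asymptotic direction of the polar part of `∑ j, exp (s w j) • E j`. -/
lemma exists_subseq_tendsto_log {w : Fin (N + 1) → ℤ} (hw : StrictMono w)
    {E Q : Fin (N + 1) → Matrix (Fin n) (Fin n) ℂ} (hQ : CompleteOrthogonalIdempotents Q)
    (hs : ∀ j, star (Q j) = Q j) (hQE : ∀ i j, i < j → Q i * E j = 0)
    (hEQ : ∀ i j, i < j → E i * Q j = 0) {Y : ℕ → Matrix (Fin n) (Fin n) ℂ}
    (hY : ∀ k, star (Y k) = Y k)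
    (h₁ : ∀ k, NormedSpace.exp ((2 : ℝ) • Y k) = (∑ j, Real.exp (k * w j) • E j) *
      star (∑ j, Real.exp (k * w j) • E j))
    (h₂ : ∀ k, NormedSpace.exp ((2 : ℝ) • (-Y k)) = star (∑ j, Real.exp (-(k * w j)) • E j) *
      (∑ j, Real.exp (-(k * w j)) • E j)) :
    ∃ φ : ℕ → ℕ, StrictMono φ ∧
      Tendsto (fun k => ((φ k : ℝ))⁻¹ • Y (φ k)) atTop (𝓝 (∑ j, (w j : ℝ) • Q j)) := by
  classical
  -- `up i` and `down i` belong to the indices `≥ i` and `≤ i`, and overlap in `Q i`. By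
  -- triangularity only the `E j` with `j ≥ i` survive against `up i`, and only those with `j ≤ i`
  -- against `down i`, so the rescaled products below converge.
  let up : Fin (N + 1) → Matrix (Fin n) (Fin n) ℂ := fun i => ∑ j ∈ Finset.Ici i, Q j
  let down : Fin (N + 1) → Matrix (Fin n) (Fin n) ℂ := fun i => ∑ j ∈ Finset.Iic i, Q j
  have sup : ∀ i, star (up i) = up i := fun i => by simp [up, star_sum, hs]
  have sdown : ∀ i, star (down i) = down i := fun i => by simp [down, star_sum, hs]
  have upQ : ∀ i, up i * Q i = Q i := fun i => by simp [up, Finset.sum_mul, hQ.mul_eq]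
  have Qup : ∀ i, Q i * up i = Q i := fun i => by simp [up, Finset.mul_sum, hQ.mul_eq]
  have downQ : ∀ i, down i * Q i = Q i := fun i => by simp [down, Finset.sum_mul, hQ.mul_eq]
  have Qdown : ∀ i, Q i * down i = Q i := fun i => by simp [down, Finset.mul_sum, hQ.mul_eq]
  have Eup : ∀ i j, j < i → E j * up i = 0 := by
    intro i j hij
    simp only [up, Finset.mul_sum]
    exact Finset.sum_eq_zero fun a ha => hEQ _ _ (hij.trans_le (Finset.mem_Ici.1 ha))
  have downE : ∀ i j, i < j → down i * E j = 0 := by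
    intro i j hij
    simp only [down, Finset.sum_mul]
    exact Finset.sum_eq_zero fun a ha => hQE _ _ ((Finset.mem_Iic.1 ha).trans_lt hij)
  have updown : ∀ i, up i + down i = 1 + Q i := by
    intro i
    rw [← hQ.complete]
    simp only [up, down]
    rw [← Finset.sum_union_inter]
    have e1 : Finset.Ici i ∪ Finset.Iic i = Finset.univ := by
      ext a; simpa using le_total i a
    have e2 : Finset.Ici i ∩ Finset.Iic i = {i} := by
      ext a; simp [le_antisymm_iff, and_comm]
    rw [e1, e2, Finset.sum_singleton]
  have limUp : ∀ i, ∃ D, Tendsto (fun k : ℕ => Real.exp (-((k : ℝ) * -(w i : ℝ))) •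
      ((∑ j, Real.exp (-(k * w j)) • E j) * up i)) atTop (𝓝 D) := by
    intro i
    obtain ⟨D, hD⟩ := exists_tendsto_sum_exp_smul (c := fun j => (w i : ℝ) - w j)
      (F := fun j => E j * up i) (fun j hj => by
        have : i ≤ j := not_lt.1 fun h => hj (Eup i j h)
        have := hw.monotone this
        rw [sub_nonpos]
        exact_mod_cast this)
    refine ⟨D, (hD.comp tendsto_natCast_atTop_atTop).congr fun k => ?_⟩
    simp only [Function.comp, Finset.sum_mul, Finset.smul_sum, smul_mul_assoc, smul_smul,
      ← Real.exp_add]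
    refine Finset.sum_congr rfl fun j _ => ?_
    congr 2
    ring
  have limDown : ∀ i, ∃ D, Tendsto (fun k : ℕ => Real.exp (-((k : ℝ) * (w i : ℝ))) •
      (star (∑ j, Real.exp (k * w j) • E j) * down i)) atTop (𝓝 D) := by
    intro i
    obtain ⟨D, hD⟩ := exists_tendsto_sum_exp_smul (c := fun j => (w j : ℝ) - w i)
      (F := fun j => star (down i * E j)) (fun j hj => by
        have : j ≤ i := not_lt.1 fun h => hj (by rw [downE i j h, star_zero])
        have := hw.monotone this
        rw [sub_nonpos]
        exact_mod_cast this)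
    refine ⟨D, (hD.comp tendsto_natCast_atTop_atTop).congr fun k => ?_⟩
    simp only [Function.comp, star_sum, Finset.sum_mul, Finset.smul_sum, star_smul, star_mul,
      star_trivial, sdown, smul_mul_assoc, smul_smul, ← Real.exp_add]
    refine Finset.sum_congr rfl fun j _ => ?_
    congr 2
    ring
  choose D hD using limUp
  choose C hC using limDown
  have hYn : ∀ k, star (-Y k) = -Y k := fun k => by rw [star_neg, hY]
  have h₁' : ∀ k, NormedSpace.exp ((2 : ℝ) • Y k) = star (star (∑ j, Real.exp (k * w j) • E j)) *
      star (∑ j, Real.exp (k * w j) • E j) := fun k => by rw [star_star, h₁]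
  -- Since `up 0` and `down N` are the identity, the two extreme estimates bound `Y k / k` from
  -- below and above; compactness yields a convergent subsequence.
  have hbdd : ∃ φ : ℕ → ℕ, StrictMono φ ∧
      ∃ X, Tendsto (fun k => ((φ k : ℝ))⁻¹ • Y (φ k)) atTop (𝓝 X) := by
    have up0 : up 0 = 1 := by simp [up, ← hQ.complete, Finset.Ici_zero_eq_univ]
    have downN : down (Fin.last N) = 1 := by
      have : (Finset.Iic (Fin.last N)) = Finset.univ := by ext a; simp [Fin.le_last]
      simp only [down, this, hQ.complete]
    open scoped Matrix.Norms.L2Operator in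
    have h0 : Tendsto (fun k : ℕ => (2 * (k : ℝ))⁻¹) atTop (𝓝 0) :=
      tendsto_inv_atTop_zero.comp (tendsto_natCast_atTop_atTop.const_mul_atTop two_pos)
    have sD := (continuous_star.tendsto (D 0)).comp (hD 0)
    have sC := (continuous_star.tendsto (C (Fin.last N))).comp (hC (Fin.last N))
    have tD := (h0.smul ((sD.mul (hD 0)).sub_const (1 * 1))).add_const
      ((-(w 0 : ℝ)) • (1 : Matrix (Fin n) (Fin n) ℂ))
    have tC := (h0.smul ((sC.mul (hC (Fin.last N))).sub_const (1 * 1))).add_const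
      ((w (Fin.last N) : ℝ) • (1 : Matrix (Fin n) (Fin n) ℂ))
    obtain ⟨R, hR⟩ := ((tC.add tD).norm.add tD.norm).bddAbove_range
    have hmem : ∃ᶠ k : ℕ in atTop, ((k : ℝ)⁻¹ • Y k) ∈ Metric.closedBall
        (0 : Matrix (Fin n) (Fin n) ℂ) R := by
      refine Eventually.frequently ?_
      filter_upwards [eventually_gt_atTop 0] with k hk
      have hk' : (0 : ℝ) < k := by exact_mod_cast hk
      rw [mem_closedBall_zero_iff]
      refine le_trans ?_ (hR ⟨k, rfl⟩)
      refine norm_le_of_posSemidef_of_posSemidef ?_ ?_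
      · have := posSemidef_compression (m := w (Fin.last N)) hk' (hY k) (h₁' k)
          (sdown (Fin.last N))
        rw [downN] at this
        simp only [downN, Function.comp]
        convert this using 1
        noncomm_ring
      · have := posSemidef_compression (m := -w 0) hk' (hYn k) (h₂ k) (sup 0)
        rw [up0] at this
        simp only [up0, Function.comp]
        convert this using 1
        rw [smul_neg]
        noncomm_ring
    obtain ⟨X, -, φ, hφ, hX⟩ := (isCompact_closedBall _ _).tendsto_subseq' hmem
    exact ⟨φ, hφ, X, hX⟩
  obtain ⟨φ, hφ, X, hX⟩ := hbdd
  have hφ' : Tendsto (fun k => (φ k : ℝ)) atTop atTop :=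
    tendsto_natCast_atTop_atTop.comp hφ.tendsto_atTop
  have hXQ : ∀ i, X * Q i = (w i : ℝ) • Q i := by
    intro i
    -- In the limit, `w i - X` compressed to `down i` and `X - w i` compressed to `up i` are both
    -- positive semidefinite.
    have p1 := posSemidef_of_tendsto hφ' (fun k => hY (φ k)) (fun k => h₁' (φ k)) (sdown i)
      ((hC i).comp hφ.tendsto_atTop) hX
    have hXn : Tendsto (fun k => ((φ k : ℝ))⁻¹ • (-Y (φ k))) atTop (𝓝 (-X)) := by
      simpa only [smul_neg] using hX.neg
    have p2 := posSemidef_of_tendsto hφ' (fun k => hYn (φ k)) (fun k => h₂ (φ k)) (sup i)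
      ((hD i).comp hφ.tendsto_atTop) hXn
    set W := X - (w i : ℝ) • (1 : Matrix (Fin n) (Fin n) ℂ) with hW
    have p1' : (down i * (-W) * down i).PosSemidef := by
      rw [hW, neg_sub]; exact p1
    have p2' : (up i * W * up i).PosSemidef := by
      convert p2 using 3
      rw [hW, neg_smul]; abel
    have q1 := p1'.conjTranspose_mul_mul_same (Q i)
    have q2 := p2'.conjTranspose_mul_mul_same (Q i)
    rw [← Matrix.star_eq_conjTranspose, hs] at q1 q2
    have r1 : Q i * (down i * (-W) * down i) * Q i = -(Q i * W * Q i) := by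
      simp only [mul_assoc]
      rw [downQ, ← mul_assoc, Qdown]
      noncomm_ring
    have r2 : Q i * (up i * W * up i) * Q i = Q i * W * Q i := by
      simp only [mul_assoc]
      rw [upQ, ← mul_assoc, Qup]
    rw [r1] at q1
    rw [r2] at q2
    -- On the overlap `Q i` both signs hold, so the compression of `W` vanishes; semidefiniteness
    -- then also kills the off-diagonal blocks `down i * W * Q i` and `up i * W * Q i`.
    have z : Q i * W * Q i = 0 := by
      open scoped MatrixOrder in
      exact le_antisymm (neg_nonneg.1 q1.nonneg) q2.nonneg
    have z1 := mul_eq_zero_of_posSemidef p1' (Q := Q i) (by rw [hs, r1, z, neg_zero])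
    have z2 := mul_eq_zero_of_posSemidef p2' (Q := Q i) (by rw [hs, r2, z])
    rw [mul_assoc, downQ, mul_neg, neg_mul, neg_eq_zero] at z1
    rw [mul_assoc, upQ] at z2
    -- The sum of the two vanishing products; as `Q i * W * Q i = 0` as well, only `W * Q i = 0`
    -- remains.
    have z3 : (1 + Q i) * (W * Q i) = 0 := by
      rw [← updown, add_mul, ← mul_assoc, ← mul_assoc, z1, z2, add_zero]
    rw [add_mul, one_mul, ← mul_assoc, z, add_zero, hW, sub_mul, smul_mul_assoc, one_mul,
      sub_eq_zero] at z3
    exact z3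
  refine ⟨φ, hφ, ?_⟩
  have : X = ∑ j, (w j : ℝ) • Q j := by
    rw [← mul_one X, ← hQ.complete, Finset.mul_sum]
    exact Finset.sum_congr rfl fun j _ => hXQ j
  rwa [← this]

end Ray

lemma neBot_comap_units_nhds_zero : (comap (fun t : ℂˣ => (t : ℂ)) (𝓝 0)).NeBot := by
  rw [comap_neBot_iff_frequently]
  have h : ∃ᶠ y : ℂ in 𝓝[≠] 0, y ∈ ({0}ᶜ : Set ℂ) :=
    (eventually_mem_nhdsWithin (a := (0 : ℂ)) (s := {0}ᶜ)).frequently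
  exact (h.filter_mono nhdsWithin_le_nhds).mono fun y hy => ⟨Units.mk0 y hy, rfl⟩

lemma tendsto_units_zpow {m : ℤ} (hm : 0 < m) :
    Tendsto (fun t : ℂˣ => (t : ℂ) ^ m) (comap (fun t : ℂˣ => (t : ℂ)) (𝓝 0)) (𝓝 0) := by
  have h := (continuousAt_zpow₀ (0 : ℂ) m (Or.inr hm.le)).tendsto
  rw [zero_zpow m hm.ne'] at h
  exact h.comp tendsto_comap

lemma eq_of_exp_mul_I_eq {u u' : ℝ}
    (h : ∀ s : ℝ, Complex.exp (s * (u * Complex.I)) = Complex.exp (s * (u' * Complex.I))) :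
    u = u' := by
  have e : ∀ c : ℂ, HasDerivAt (fun s : ℝ => Complex.exp (s * c)) c 0 := by
    intro c
    have h1 : HasDerivAt (fun s : ℝ => (s : ℂ) * c) (1 * c) 0 :=
      (Complex.ofRealCLM.hasDerivAt (x := (0 : ℝ))).mul_const c
    simpa using h1.cexp
  have h1 := e (u * Complex.I)
  rw [funext h] at h1
  have h2 := h1.unique (e (u' * Complex.I))
  exact_mod_cast mul_right_cancel₀ Complex.I_ne_zero h2

/-! ### Conjugating a one-parameter subgroup into position with respect to `K` -/

namespace ComplexReductiveGroup

variable {n : ℕ} {G : ComplexReductiveGroup n}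

/-- The weight decomposition of a one-parameter subgroup. -/
lemma OnePS.exists_weights (l : G.OnePS) : ∃ (N k : ℕ) (E : Fin (N + 1) → Matrix (Fin n) (Fin n) ℂ),
    CompleteOrthogonalIdempotents E ∧ ∀ t : ℂˣ,
      ((l.toHom t : GL (Fin n) ℂ) : Matrix (Fin n) (Fin n) ℂ) =
        ∑ j : Fin (N + 1), ((t : ℂ) ^ ((j : ℤ) - k)) • E j := by
  obtain ⟨N, k, c, hc⟩ := IsLaurent.exists_coeff
    (f := fun (ij : Fin n × Fin n) t =>
      ((l.toHom t : GL (Fin n) ℂ) : Matrix (Fin n) (Fin n) ℂ) ij.1 ij.2)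
    (fun ij => l.regular ij.1 ij.2)
  have h : ∀ t : ℂˣ, ((l.toHom t : GL (Fin n) ℂ) : Matrix (Fin n) (Fin n) ℂ) =
      ∑ j : Fin (N + 1), ((t : ℂ) ^ ((j : ℤ) - k)) • Matrix.of fun a b => c (a, b) j := by
    intro t
    ext a b
    rw [hc (a, b) t]
    simp [Matrix.sum_apply]
  refine ⟨N, k, fun j => Matrix.of fun a b => c (a, b) j, ?_, h⟩
  exact completeOrthogonalIdempotents_of_hom (w := fun j : Fin (N + 1) => (j : ℤ) - k)
    (fun i j hij => Fin.ext (by simpa using hij))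
    ((Units.coeHom _).comp (G.toSubgroup.subtype.comp l.toHom)) h

/-- If `exp (r ∑ j, w j • Q j) ∈ G` for all real `r`, then `∑ j, t ^ w j • Q j ∈ G`. -/
lemma toricHom_mem_of_exp_mem {ι : Type*} [Fintype ι] {Q : ι → Matrix (Fin n) (Fin n) ℂ}
    (hQ : CompleteOrthogonalIdempotents Q) (w : ι → ℤ)
    (h : ∀ r : ℝ, expGL (r • ∑ j, (w j : ℝ) • Q j) ∈ G.toSubgroup) (t : ℂˣ) :
    toricHom hQ w t ∈ G.toSubgroup := by
  obtain ⟨S, hS⟩ := G.zariski_closed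
  refine (hS _).2 fun p hp => ?_
  -- The characters `r ↦ e^{rγ}` of `ℝ`, for integers `γ`, are distinct; hence polynomial identities
  -- on the real ray extend to all `t`, through `ψ γ = t ^ γ`.
  let χ : Multiplicative ℤ →* (Multiplicative ℝ →* ℂ) :=
    { toFun := fun γ =>
        { toFun := fun r => Complex.exp ((r.toAdd : ℂ) * (γ.toAdd : ℂ))
          map_one' := by simp
          map_mul' := fun a b => by rw [← Complex.exp_add]; simp [add_mul] }
      map_one' := by ext; simp
      map_mul' := fun a b => by ext; simp [← Complex.exp_add, mul_add] }
  let ψ : Multiplicative ℤ →* ℂ :=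
    { toFun := fun γ => (t : ℂ) ^ γ.toAdd
      map_one' := by simp
      map_mul' := fun a b => by simp [zpow_add₀] }
  have hχ : Function.Injective χ := by
    intro a b hab
    have h1 : Complex.exp (((1 : ℝ) : ℂ) * (a.toAdd : ℂ)) =
        Complex.exp (((1 : ℝ) : ℂ) * (b.toAdd : ℂ)) :=
      DFunLike.congr_fun hab (Multiplicative.ofAdd (1 : ℝ))
    rw [Complex.ofReal_one, one_mul, one_mul, ← Complex.ofReal_intCast, ← Complex.ofReal_intCast,
      ← Complex.ofReal_exp, ← Complex.ofReal_exp] at h1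
    have h2 := Real.exp_injective (Complex.ofReal_injective h1)
    exact Multiplicative.toAdd.injective (by exact_mod_cast h2)
  rw [coe_toricHom]
  refine eval_matrix_eq_zero_of_characters χ hχ ψ Q w p fun r => ?_
  rw [← (hS _).1 (h r.toAdd) p hp]
  congr 2
  ext ij
  rw [coe_expGL, Finset.smul_sum]
  simp only [← Complex.coe_smul, smul_smul]
  rw [exp_sum_smul hQ]
  simp [χ]

/-- A one-parameter subgroup has a conjugate `l' = g l g⁻¹` that maps the unit circle to `K`, with
`l' (t) l (t)⁻¹ → g` for `t → 0`. -/
theorem OnePS.exists_conj_compact (l : G.OnePS) :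
    ∃ (l' : G.OnePS) (g : G.toSubgroup) (α : G.lieK),
      (∀ t, l'.toHom t = g * l.toHom t * g⁻¹) ∧
      (∀ t : ℝ, l'.toHom (Circle.toUnits (Circle.exp (2 * Real.pi * t))) = G.exp α t) ∧
      Tendsto (fun t : ℂˣ => ((l'.toHom t * (l.toHom t)⁻¹ : G.toSubgroup) : GL (Fin n) ℂ).val)
        (comap (fun t : ℂˣ => (t : ℂ)) (𝓝 0)) (𝓝 (g : GL (Fin n) ℂ).val) := by
  obtain ⟨N, k, E, hE, hl⟩ := l.exists_weights
  set w : Fin (N + 1) → ℤ := fun j => (j : ℤ) - k with hwdef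
  have hw : StrictMono w := fun i j hij => by
    have : (i : ℤ) < j := by exact_mod_cast hij
    simp only [hwdef]; omega
  obtain ⟨Q, hQ, hs, hQE, hEQ, hEQE⟩ := exists_orthogonalization hE
  have hlr : ∀ r : ℝ, ((l.toHom (Units.mk0 (Complex.exp r) (Complex.exp_ne_zero _)) :
      GL (Fin n) ℂ) : Matrix (Fin n) (Fin n) ℂ) = ∑ j, Real.exp (r * w j) • E j := by
    intro r
    rw [hl]
    refine Finset.sum_congr rfl fun j _ => ?_
    rw [← Complex.coe_smul (Real.exp _), Units.val_mk0, ← Complex.exp_int_mul]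
    congr 1
    push_cast [hwdef]
    rw [mul_comm]
  have hmem : ∀ t, toricHom hQ w t ∈ G.toSubgroup := by
    refine toricHom_mem_of_exp_mem hQ w fun r => ?_
    -- Sample points `e^k`. The logarithm `Z k` of `u_k u_k^*` generates a ray in `G`, and the
    -- directions `Z k / (2k)` converge along a subsequence to `∑ w j • Q j`. As `G` is closed, the
    -- limiting ray lies in `G`.
    let x : ℕ → ℂˣ := fun k => Units.mk0 (Complex.exp (k : ℝ)) (Complex.exp_ne_zero _)
    have hx : ∀ k : ℕ, (x k)⁻¹ = Units.mk0 (Complex.exp ((-k : ℝ) : ℝ)) (Complex.exp_ne_zero _) := by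
      intro k
      refine Units.ext ?_
      simp [x, Complex.exp_neg]
    let u : ℕ → GL (Fin n) ℂ := fun k => (l.toHom (x k) : GL (Fin n) ℂ)
    have hu : ∀ k, u k ∈ G.toSubgroup := fun k => (l.toHom (x k)).2
    choose Z hZ hexp hZmem _ using fun k => G.exists_log_mem
      (mul_mem (G.star_mem _ (G.star_mem _ (hu k))) (G.star_mem _ (hu k)))
      (posDef_star_mul_self (star (u k)))
    obtain ⟨φ, hφ, hlim⟩ := exists_subseq_tendsto_log hw hQ hs hQE hEQ
      (Y := fun k => (2⁻¹ : ℝ) • Z k) (fun k => by rw [star_smul, hZ, star_trivial])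
      (fun k => by
        rw [smul_smul, mul_inv_cancel₀ two_ne_zero, one_smul, hexp, star_star, ← hlr]
        rfl)
      (fun k => by
        have h1 : ∑ j, Real.exp (-((k : ℝ) * w j)) • E j = ((u k)⁻¹).val := by
          simp only [← neg_mul]
          rw [← hlr, ← hx, map_inv]
          rfl
        rw [smul_neg, smul_smul, mul_inv_cancel₀ two_ne_zero, one_smul, Matrix.exp_neg, hexp, h1,
          ← Matrix.coe_units_inv, star_star, mul_inv_rev, ← star_inv]
        rfl)
    have hcont : Continuous fun M : Matrix (Fin n) (Fin n) ℂ => NormedSpace.exp (r • M) := by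
      open scoped Matrix.Norms.L2Operator in
      let _ : NormedAlgebra ℚ (Matrix (Fin n) (Fin n) ℂ) := .restrictScalars ℚ ℂ _
      exact NormedSpace.exp_continuous.comp (continuous_const_smul r)
    refine G.mem_of_tendsto (F := atTop)
      (u := fun k => expGL ((r * (φ k : ℝ)⁻¹ * 2⁻¹) • Z (φ k))) (fun k => hZmem _ _) ?_
    refine ((hcont.tendsto _).comp hlim).congr fun k => ?_
    simp [smul_smul, mul_assoc]
  -- The blocks with different indices cancel because the `Q j` are orthogonal, and `E i * Q i * E i
  -- = E i` handles the diagonal.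
  have hg : (∑ j, E j * Q j) * (∑ j, Q j * E j) = 1 := by
    rw [← hE.complete, Finset.sum_mul]
    refine Finset.sum_congr rfl fun i _ => ?_
    rw [Finset.mul_sum, Finset.sum_eq_single i]
    · rw [mul_assoc, ← mul_assoc (Q i), (hQ.idem i).eq, ← mul_assoc, hEQE]
    · intro j _ hij
      rw [mul_assoc, ← mul_assoc (Q i), hQ.ortho hij.symm, zero_mul, mul_zero]
    · simp
  let g : GL (Fin n) ℂ := ⟨∑ j, Q j * E j, ∑ j, E j * Q j, mul_eq_one_comm.1 hg, hg⟩
  have hlim : Tendsto (fun t : ℂˣ => (toricHom hQ w t * (l.toHom t : GL (Fin n) ℂ)⁻¹).val)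
      (comap (fun t : ℂˣ => (t : ℂ)) (𝓝 0)) (𝓝 g.val) := by
    have h1 : ∀ t : ℂˣ, (toricHom hQ w t * (l.toHom t : GL (Fin n) ℂ)⁻¹).val =
        ∑ i, ∑ j, ((t : ℂ) ^ (w i - w j)) • (Q i * E j) := by
      intro t
      have h2 : ((l.toHom t : GL (Fin n) ℂ)⁻¹).val = ∑ j, ((t : ℂ) ^ (-w j)) • E j := by
        have h3 := hl t⁻¹
        rw [map_inv] at h3
        rw [show ((l.toHom t : GL (Fin n) ℂ)⁻¹).val =
          (((l.toHom t)⁻¹ : G.toSubgroup) : GL (Fin n) ℂ).val from rfl, h3]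
        simp [zpow_neg, hwdef, -neg_sub]
      rw [Units.val_mul, h2, coe_toricHom, Finset.sum_mul]
      refine Finset.sum_congr rfl fun i _ => ?_
      rw [Finset.mul_sum]
      refine Finset.sum_congr rfl fun j _ => ?_
      rw [smul_mul_smul_comm, ← zpow_add₀ t.ne_zero, sub_eq_add_neg]
    simp only [h1]
    -- In `∑ t ^ (w i - w j) • Q i E j` the terms with `i < j` are zero, those with `i > j` tend to
    -- zero, and the diagonal ones are constant.
    rw [show g.val = ∑ i, ∑ j, if j = i then Q i * E j else 0 by simp [g]]
    refine tendsto_finsetSum _ fun i _ => tendsto_finsetSum _ fun j _ => ?_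
    rcases lt_trichotomy i j with h | h | h
    · simpa [hQE i j h, h.ne'] using tendsto_const_nhds
    · simpa [h] using tendsto_const_nhds
    · rw [if_neg h.ne, ← zero_smul ℂ (Q i * E j)]
      exact (tendsto_units_zpow (sub_pos.2 (hw h))).smul_const _
  have hgG : g ∈ G.toSubgroup := by
    have := neBot_comap_units_nhds_zero
    exact G.mem_of_tendsto (fun t => mul_mem (hmem t) (inv_mem (l.toHom t).2)) hlim
  -- `g` intertwines the two gradings: `Q i * g` and `g * E i` both equal `Q i * E i`.
  have hconj : ∀ t, toricHom hQ w t = g * l.toHom t * g⁻¹ := by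
    intro t
    rw [eq_mul_inv_iff_mul_eq]
    refine Units.ext ?_
    rw [Units.val_mul, Units.val_mul, hl, coe_toricHom]
    simp only [g, Finset.sum_mul, Finset.mul_sum]
    rw [Finset.sum_comm]
    refine Finset.sum_congr rfl fun i _ => Finset.sum_congr rfl fun j _ => ?_
    by_cases hij : i = j
    · subst hij
      rw [smul_mul_assoc, mul_smul_comm, ← mul_assoc, (hQ.idem i).eq, mul_assoc, (hE.idem i).eq]
    · rw [smul_mul_assoc, mul_smul_comm, ← mul_assoc, hQ.ortho hij, mul_assoc, hE.ortho (Ne.symm hij),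
        zero_mul, mul_zero, smul_zero]
  obtain ⟨t₀, ht₀⟩ := l.nontrivial
  have hne : toricHom hQ w t₀ ≠ 1 := by
    intro h
    rw [hconj, mul_inv_eq_one, mul_eq_left] at h
    exact ht₀ (Subtype.ext h)
  refine ⟨G.toricOnePS hQ w hmem ⟨t₀, hne⟩, ⟨g, hgG⟩,
    ⟨toricWeight Q w, toricWeight_mem_lieK hQ hs w hmem⟩, fun t => Subtype.ext (hconj t),
    fun t => Subtype.ext (expGL_toricWeight hQ w t).symm, hlim⟩

end ComplexReductiveGroup

/-! ### One-parameter subgroups in the closure of `exp (ℝβ)` -/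

/-- Finitely many real numbers are integral combinations of real numbers that are linearly
independent over `ℤ`. -/
lemma exists_integral_coordinates {ι : Type*} [Finite ι] (θ : ι → ℝ) :
    ∃ (m : ℕ) (γ : Fin m → ℝ) (a : ι → Fin m → ℤ), LinearIndependent ℤ γ ∧
      ∀ j, θ j = ∑ k, (a j k : ℝ) * γ k := by
  -- A finitely generated subgroup of `ℝ` is torsion-free, hence free; `γ` is a basis of it.
  let S := Submodule.span ℤ (Set.range θ)
  have : Module.Finite ℤ S := Module.Finite.span_of_finite ℤ (Set.finite_range θ)
  let b := Module.finBasis ℤ S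
  refine ⟨_, fun k => (b k : ℝ), fun j k => b.repr ⟨θ j, Submodule.subset_span ⟨j, rfl⟩⟩ k,
    b.linearIndependent.map' S.subtype (Submodule.ker_subtype S), fun j => ?_⟩
  have h := congrArg Subtype.val (b.sum_repr ⟨θ j, Submodule.subset_span ⟨j, rfl⟩⟩)
  rw [Submodule.coe_sum] at h
  exact h.symm.trans (Finset.sum_congr rfl fun k _ => by simp)

namespace ComplexReductiveGroup

variable {n : ℕ} {G : ComplexReductiveGroup n}

/-- An element `β` of `𝔨` is a real linear combination of elements of `𝔨` whose integral linear
combinations generate one-parameter subgroups in the Zariski closure of `exp (ℝβ)`. -/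
theorem exists_onePS_in_torus (β : G.lieK) :
    ∃ (m : ℕ) (c : Fin m → ℝ) (X : Fin m → G.lieK), β = ∑ k, c k • X k ∧
      ∀ q : Fin m → ℤ, ∑ k, (q k : ℝ) • X k ≠ 0 → ∃ l : G.OnePS,
        (∀ t : ℝ, l.toHom (Circle.toUnits (Circle.exp (2 * Real.pi * t))) =
          G.exp (∑ k, (q k : ℝ) • X k) t) ∧
        ∀ p : MvPolynomial (Fin n × Fin n) ℂ,
          (∀ s : ℝ, MvPolynomial.eval
            (fun ij => (G.exp β s : GL (Fin n) ℂ).val ij.1 ij.2) p = 0) →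
          ∀ t, MvPolynomial.eval (fun ij => (l.toHom t : GL (Fin n) ℂ).val ij.1 ij.2) p = 0 := by
  have hH : (-Complex.I • (β : Matrix (Fin n) (Fin n) ℂ)).IsHermitian := by
    change star _ = _
    rw [star_smul, G.star_lieK]
    simp
  obtain ⟨P, hP, hs, hM⟩ := exists_spectral_projections hH
  set θ := hH.eigenvalues
  have hβ : (β : Matrix (Fin n) (Fin n) ℂ) = ∑ j, (Complex.I * θ j) • P j := by
    have := congrArg (Complex.I • ·) hM
    simp only [smul_smul, Finset.smul_sum, mul_neg, Complex.I_mul_I, neg_neg, one_smul] at this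
    exact this
  have hexp : ∀ s : ℝ, (G.exp β s : GL (Fin n) ℂ).val =
      ∑ j, Complex.exp (s * (θ j * Complex.I)) • P j := by
    intro s
    rw [show (G.exp β s : GL (Fin n) ℂ).val = NormedSpace.exp (s • β.val) from rfl, hβ,
      Finset.smul_sum]
    simp only [← Complex.coe_smul s, smul_smul]
    rw [exp_sum_smul hP]
    simp only [mul_comm Complex.I]
  obtain ⟨m, γ, a, hγ, hθ⟩ := exists_integral_coordinates θ
  have hvan : ∀ (q : Fin m → ℤ) (p : MvPolynomial (Fin n × Fin n) ℂ),
      (∀ s : ℝ, MvPolynomial.eval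
        (fun ij => (G.exp β s : GL (Fin n) ℂ).val ij.1 ij.2) p = 0) → ∀ t : ℂˣ,
      MvPolynomial.eval
        (fun ij => (toricHom hP (fun j => ∑ k, q k * a j k) t).val ij.1 ij.2) p = 0 := by
    intro q p hp t
    -- Integral vectors `x` index the characters `s ↦ exp (i s ∑ x_k γ_k)`, which are distinct
    -- because the `γ_k` are independent over `ℤ`. The character `ψ` puts the integers `q_k` in
    -- place of the `γ_k`.
    let χ : Multiplicative (Fin m → ℤ) →* (Multiplicative ℝ →* ℂ) :=
      { toFun := fun x =>
          { toFun := fun s => Complex.exp (s.toAdd *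
              (((∑ k, (x.toAdd k : ℝ) * γ k : ℝ) : ℂ) * Complex.I))
            map_one' := by simp
            map_mul' := fun s t => by rw [← Complex.exp_add]; simp [add_mul] }
        map_one' := by ext; simp
        map_mul' := fun x y => by
          ext; simp [← Complex.exp_add, add_mul, mul_add, Finset.sum_add_distrib] }
    let ψ : Multiplicative (Fin m → ℤ) →* ℂ :=
      { toFun := fun x => (t : ℂ) ^ (∑ k, q k * x.toAdd k)
        map_one' := by simp
        map_mul' := fun x y => by simp [mul_add, Finset.sum_add_distrib, zpow_add₀] }
    have hχ : Function.Injective χ := by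
      intro x y hxy
      have h1 := eq_of_exp_mul_I_eq fun s =>
        (DFunLike.congr_fun hxy (Multiplicative.ofAdd s) :)
      rw [← sub_eq_zero, ← Finset.sum_sub_distrib] at h1
      refine Multiplicative.toAdd.injective (funext fun k => ?_)
      have h2 := Fintype.linearIndependent_iff.1 hγ (fun k => x.toAdd k - y.toAdd k)
        (by rw [← h1]; simp [sub_mul]) k
      exact sub_eq_zero.1 h2
    rw [coe_toricHom]
    refine eval_matrix_eq_zero_of_characters χ hχ ψ P a p fun s => ?_
    rw [← hp s.toAdd]
    congr 2
    ext ij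
    rw [hexp]
    simp only [hθ]
    rfl
  have hmem : ∀ (q : Fin m → ℤ) (t : ℂˣ),
      toricHom hP (fun j => ∑ k, q k * a j k) t ∈ G.toSubgroup := by
    intro q t
    obtain ⟨S, hS⟩ := G.zariski_closed
    exact (hS _).2 fun p hp => hvan q p (fun s => (hS _).1 (G.exp β s).2 p hp) t
  have hmem' : ∀ k (t : ℂˣ), toricHom hP (fun j => a j k) t ∈ G.toSubgroup := by
    intro k t
    simpa [Pi.single_apply] using hmem (Pi.single k 1) t
  have hsum : ∀ c : Fin m → ℝ, ∑ k, c k • toricWeight P (fun j => a j k) =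
      ∑ j, (2 * Real.pi * Complex.I * (∑ k, c k * a j k : ℝ)) • P j := by
    intro c
    simp only [toricWeight, Finset.smul_sum, ← Complex.coe_smul, smul_smul]
    rw [Finset.sum_comm]
    refine Finset.sum_congr rfl fun j _ => ?_
    rw [← Finset.sum_smul]
    congr 1
    push_cast
    rw [Finset.mul_sum]
    exact Finset.sum_congr rfl fun k _ => by ring
  let X : Fin m → G.lieK := fun k =>
    ⟨toricWeight P (fun j => a j k), toricWeight_mem_lieK hP hs _ (hmem' k)⟩
  -- The division by `2π` compensates the factor `2πi` in `toricWeight`.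
  refine ⟨m, fun k => γ k / (2 * Real.pi), X, Subtype.ext ?_, fun q hq => ?_⟩
  · rw [Submodule.coe_sum]
    simp only [Submodule.coe_smul, X]
    rw [hsum, hβ]
    refine Finset.sum_congr rfl fun j _ => ?_
    congr 1
    have h1 : ∑ k, γ k / (2 * Real.pi) * (a j k : ℝ) = θ j / (2 * Real.pi) := by
      rw [hθ, Finset.sum_div]
      exact Finset.sum_congr rfl fun k _ => by ring
    rw [h1]
    have : (Real.pi : ℂ) ≠ 0 := by exact_mod_cast Real.pi_ne_zero
    push_cast
    field_simp
  · have hX : (∑ k, (q k : ℝ) • X k : G.lieK).val = toricWeight P (fun j => ∑ k, q k * a j k) := by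
      rw [Submodule.coe_sum]
      simp only [Submodule.coe_smul, X]
      rw [hsum, toricWeight]
      push_cast
      rfl
    have hE : ∀ t : ℝ, toricHom hP (fun j => ∑ k, q k * a j k)
        (Circle.toUnits (Circle.exp (2 * Real.pi * t))) =
          (G.exp (∑ k, (q k : ℝ) • X k) t : GL (Fin n) ℂ) := by
      intro t
      rw [← expGL_toricWeight, ← hX]
      rfl
    refine ⟨G.toricOnePS hP _ (hmem q) ?_, fun t => Subtype.ext (hE t), fun p hp => hvan q p hp⟩
    by_contra! h
    refine hq (Subtype.ext (eq_of_exp_smul_eq fun t => ?_))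
    have h1 := congrArg Units.val ((hE t).symm.trans (h _))
    rw [show ((0 : G.lieK) : Matrix (Fin n) (Fin n) ℂ) = 0 from rfl, smul_zero,
      NormedSpace.exp_zero]
    exact h1

end ComplexReductiveGroup

/-! ### Regular functions along one-parameter subgroups -/

namespace ComplexReductiveGroup

variable {n : ℕ} {G : ComplexReductiveGroup n}

/-- The inverse determinant causes no trouble: `det (l t)⁻¹ = det (l t⁻¹)` is again a Laurent
polynomial. -/
lemma IsRegular.isLaurent {f : G.toSubgroup → ℂ} (hf : G.IsRegular f) (l : G.OnePS) :
    IsLaurent fun t => f (l.toHom t) := by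
  obtain ⟨p, k, h⟩ := hf
  have h1 : IsLaurent fun t => ((l.toHom t : GL (Fin n) ℂ) : Matrix (Fin n) (Fin n) ℂ).det :=
    IsLaurent.det l.regular
  have h2 := (IsLaurent.eval_mvPolynomial (f := fun (ij : Fin n × Fin n) t =>
    ((l.toHom t : GL (Fin n) ℂ) : Matrix (Fin n) (Fin n) ℂ) ij.1 ij.2)
    (fun ij => l.regular ij.1 ij.2) p).mul (h1.comp_inv.pow k)
  simp only [h]
  convert h2 using 4 with t
  rw [map_inv, Subgroup.coe_inv, Matrix.coe_units_inv, Matrix.det_nonsing_inv,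
    Ring.inverse_eq_inv']

lemma IsRegular.tendsto {f : G.toSubgroup → ℂ} (hf : G.IsRegular f) {κ : Type*} {F : Filter κ}
    {u : κ → G.toSubgroup} {g : G.toSubgroup}
    (h : Tendsto (fun k => (u k : GL (Fin n) ℂ).val) F (𝓝 (g : GL (Fin n) ℂ).val)) :
    Tendsto (fun k => f (u k)) F (𝓝 (f g)) := by
  obtain ⟨p, k, hp⟩ := hf
  simp only [hp]
  have hc : Continuous fun M : Matrix (Fin n) (Fin n) ℂ =>
      MvPolynomial.eval (fun ij : Fin n × Fin n => M ij.1 ij.2) p :=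
    (MvPolynomial.continuous_eval p).comp (by fun_prop)
  have hd : Continuous fun M : Matrix (Fin n) (Fin n) ℂ => M.det :=
    Continuous.matrix_det continuous_id
  have hg : (g : GL (Fin n) ℂ).val.det ≠ 0 := Matrix.GeneralLinearGroup.det_ne_zero _
  exact ((hc.tendsto _).comp h).mul ((((hd.tendsto _).comp h).inv₀ hg).pow k)

/-! ### Characters -/

/-- The Laurent coefficients of `ρ ∘ l` are complete orthogonal idempotents in the field `ℂ`, so
exactly one of them is non-zero, and it equals `1`. -/
lemma Character.exists_pairing (ρ : G.Character) (l : G.OnePS) :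
    ∃ m : ℤ, ∀ t : ℂˣ, ρ.toHom (l.toHom t) = t ^ m := by
  obtain ⟨N, k, c, hc⟩ := IsLaurent.exists_coeff
    (f := fun (_ : Unit) t => (ρ.toHom (l.toHom t) : ℂ)) (fun _ => ρ.regular.isLaurent l)
  have hE := completeOrthogonalIdempotents_of_hom (w := fun j : Fin (N + 1) => (j : ℤ) - k)
    (fun i j hij => Fin.ext (by simpa using hij)) (E := c ())
    ((Units.coeHom _).comp (ρ.toHom.comp l.toHom)) (fun t => by simpa using hc () t)
  obtain ⟨j, hj⟩ : ∃ j, c () j ≠ 0 := by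
    by_contra! h
    simpa [h] using hE.complete
  have h0 : ∀ i, i ≠ j → c () i = 0 := fun i hi =>
    (mul_eq_zero.1 (hE.ortho hi)).resolve_right hj
  have h1 : c () j = 1 := by
    have := hE.complete
    rwa [Finset.sum_eq_single j (fun i _ hi => h0 i hi) (by simp)] at this
  refine ⟨(j : ℤ) - k, fun t => Units.ext ?_⟩
  have := hc () t
  rw [Finset.sum_eq_single j (fun i _ hi => by rw [h0 i hi, mul_zero]) (by simp), h1,
    mul_one] at this
  simpa using this

lemma Character.apply_onePS (ρ : G.Character) (l : G.OnePS) (t : ℂˣ) :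
    ρ.toHom (l.toHom t) = t ^ ρ.pairing l := by
  have h := ρ.exists_pairing l
  rw [Character.pairing, dif_pos h]
  exact h.choose_spec t

lemma Character.pairing_eq_of_conj (ρ : G.Character) {l l' : G.OnePS} (g : G.toSubgroup)
    (h : ∀ t, l'.toHom t = g * l.toHom t * g⁻¹) : ρ.pairing l' = ρ.pairing l := by
  have h1 : (Units.mk0 (2 : ℂ) two_ne_zero) ^ ρ.pairing l' =
      (Units.mk0 (2 : ℂ) two_ne_zero) ^ ρ.pairing l := by
    rw [← ρ.apply_onePS, ← ρ.apply_onePS, h, map_mul, map_mul, map_inv, mul_right_comm,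
      mul_inv_cancel, one_mul]
  have := two_zpow_eq_one (m := ρ.pairing l' - ρ.pairing l)
    (by rw [zpow_sub, h1, mul_inv_cancel])
  omega

lemma hasDerivAt_circle_zpow (m : ℤ) :
    HasDerivAt (fun t : ℝ => ((Circle.toUnits (Circle.exp (2 * Real.pi * t)) : ℂˣ) : ℂ) ^ m)
      (2 * Real.pi * Complex.I * m) 0 := by
  have h1 : (fun t : ℝ => ((Circle.toUnits (Circle.exp (2 * Real.pi * t)) : ℂˣ) : ℂ) ^ m) =
      fun t : ℝ => Complex.exp (t * (2 * Real.pi * Complex.I * m)) := by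
    funext t
    rw [Circle.toUnits_apply, Units.val_mk0, Circle.coe_exp, ← Complex.exp_int_mul]
    congr 1
    push_cast
    ring
  rw [h1]
  have h2 : HasDerivAt (fun s : ℝ => (s : ℂ) * (2 * Real.pi * Complex.I * m))
      (1 * (2 * Real.pi * Complex.I * m)) 0 :=
    (Complex.ofRealCLM.hasDerivAt (x := (0 : ℝ))).mul_const _
  simpa using h2.cexp

lemma Character.d_eq (ρ : G.Character) {l : G.OnePS} {α : G.lieK}
    (h : ∀ t : ℝ, l.toHom (Circle.toUnits (Circle.exp (2 * Real.pi * t))) = G.exp α t) :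
    ρ.d α = 2 * Real.pi * Complex.I * ρ.pairing l := by
  refine HasDerivAt.deriv ?_
  simp only [← h, ρ.apply_onePS, Units.val_zpow_eq_zpow_val]
  exact hasDerivAt_circle_zpow _

/-! ### The invariant inner product -/

namespace InvariantInnerProduct

variable (B : G.InvariantInnerProduct)

lemma form_self_nonneg (α : G.lieK) : 0 ≤ B.form α α := by
  by_cases h : α = 0
  · simp [h]
  · exact (B.pos α h).le

lemma norm_sq (α : G.lieK) : B.norm α ^ 2 = B.form α α := Real.sq_sqrt (B.form_self_nonneg α)

lemma norm_nonneg (α : G.lieK) : 0 ≤ B.norm α := Real.sqrt_nonneg _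

lemma norm_pos {α : G.lieK} (h : α ≠ 0) : 0 < B.norm α := Real.sqrt_pos.2 (B.pos α h)

lemma norm_smul (c : ℝ) (α : G.lieK) : B.norm (c • α) = |c| * B.norm α := by
  simp only [norm, map_smul, LinearMap.smul_apply, smul_eq_mul, ← mul_assoc]
  rw [Real.sqrt_mul (mul_self_nonneg c), Real.sqrt_mul_self_eq_abs]

lemma form_le (α β : G.lieK) : |B.form α β| ≤ B.norm α * B.norm β := by
  have h := LinearMap.BilinForm.apply_mul_apply_le_of_forall_zero_le B.form B.form_self_nonneg α β
  rw [B.symm β α] at h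
  refine abs_le_of_sq_le_sq ?_ (mul_nonneg (B.norm_nonneg _) (B.norm_nonneg _))
  rw [mul_pow, B.norm_sq, B.norm_sq, sq]
  exact h

lemma form_toDual_symm (φ : Module.Dual ℝ G.lieK) (α : G.lieK) :
    B.form ((B.form.toDual B.nondegenerate).symm φ) α = φ α :=
  LinearMap.BilinForm.apply_toDual_symm_apply ..

/-- The coordinates of `α` are pairings with the `B`-dual basis, to which Cauchy-Schwarz for `B`
applies. -/
lemma exists_bound {W : Type*} [NormedAddCommGroup W] [NormedSpace ℝ W] (L : G.lieK →ₗ[ℝ] W) :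
    ∃ C, 0 ≤ C ∧ ∀ α, ‖L α‖ ≤ C * B.norm α := by
  let b := Module.finBasis ℝ G.lieK
  let y := fun i => (B.form.toDual B.nondegenerate).symm (b.coord i)
  refine ⟨∑ i, B.norm (y i) * ‖L (b i)‖, Finset.sum_nonneg fun i _ =>
    mul_nonneg (B.norm_nonneg _) (_root_.norm_nonneg _), fun α => ?_⟩
  conv_lhs => rw [← b.sum_repr α, map_sum]
  refine (norm_sum_le _ _).trans ?_
  rw [Finset.sum_mul]
  refine Finset.sum_le_sum fun i _ => ?_
  rw [map_smul, _root_.norm_smul, Real.norm_eq_abs]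
  have h : b.repr α i = B.form (y i) α := (B.form_toDual_symm (b.coord i) α).symm
  rw [h]
  have := mul_le_mul_of_nonneg_right (B.form_le (y i) α) (_root_.norm_nonneg (L (b i)))
  linarith

/-- The norm of a one-parameter subgroup can be computed from any conjugate in `K`. -/
lemma normOnePS_eq {l : G.OnePS} (g : G.toSubgroup) {α : G.lieK}
    (h : ∀ t : ℝ, g * l.toHom (Circle.toUnits (Circle.exp (2 * Real.pi * t))) * g⁻¹ =
      G.exp α t) : B.normOnePS l = B.norm α := by
  have : {r : ℝ | ∃ (g : G.toSubgroup) (α : G.lieK),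
      (∀ t : ℝ, g * l.toHom (Circle.toUnits (Circle.exp (2 * Real.pi * t))) * g⁻¹ = G.exp α t) ∧
      r = B.norm α} = {B.norm α} := by
    refine Set.eq_singleton_iff_unique_mem.2 ⟨⟨g, α, h, rfl⟩, ?_⟩
    rintro r ⟨g', α', h', rfl⟩
    refine B.norm_eq_of_conj (g * g'⁻¹) fun t => ?_
    rw [← h, ← h']
    group
  rw [normOnePS, this, csInf_singleton]

end InvariantInnerProduct

/-! ### Infinitesimal action and weight spaces of `V` -/

namespace LinearAction

variable {V : Type*} [NormedAddCommGroup V] [InnerProductSpace ℂ V] [FiniteDimensional ℂ V]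
  (A : G.LinearAction V)

lemma hasDerivAt_infinitesimal (v : V) (α : G.lieK) :
    HasDerivAt (fun t : ℝ => A.toHom (G.exp α t) v) (A.infinitesimal v α) 0 := by
  obtain ⟨L, hL⟩ := A.hasDerivAt v
  rw [show A.infinitesimal v α = L α from (hL α).deriv]
  exact hL α

/-- The infinitesimal action of `α` as an endomorphism of `V`. -/
def infinitesimalEnd (α : G.lieK) : V →ₗ[ℂ] V where
  toFun v := A.infinitesimal v α
  map_add' v w := by
    refine (HasDerivAt.unique (A.hasDerivAt_infinitesimal (v + w) α) ?_)
    simpa using (A.hasDerivAt_infinitesimal v α).fun_add (A.hasDerivAt_infinitesimal w α)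
  map_smul' c v := by
    refine (HasDerivAt.unique (A.hasDerivAt_infinitesimal (c • v) α) ?_)
    simpa using (A.hasDerivAt_infinitesimal v α).fun_const_smul c

lemma infinitesimalEnd_apply (α : G.lieK) (v : V) :
    A.infinitesimalEnd α v = A.infinitesimal v α := rfl

lemma exp_zero_eq (α : G.lieK) : G.exp α 0 = 1 := by
  refine Subtype.ext (Units.ext ?_)
  change NormedSpace.exp ((0 : ℝ) • α.val) = 1
  rw [zero_smul, NormedSpace.exp_zero]

lemma exp_add_eq (α : G.lieK) (s t : ℝ) : G.exp α (s + t) = G.exp α s * G.exp α t :=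
  Subtype.ext (expGL_add_smul _ _ _)

/-- The derivative at `t = 0` of the constant `⟨exp (tα) v, exp (tα) w⟩`. -/
lemma inner_infinitesimal_left (α : G.lieK) (v w : V) :
    inner ℂ (A.infinitesimal v α) w = -inner ℂ v (A.infinitesimal w α) := by
  have h := (A.hasDerivAt_infinitesimal v α).inner ℂ (A.hasDerivAt_infinitesimal w α)
  have h1 : (fun t : ℝ => inner ℂ (A.toHom (G.exp α t) v) (A.toHom (G.exp α t) w)) =
      fun _ => inner ℂ v w := funext fun t => A.unitary _ (α.2 t) v w
  rw [h1, exp_zero_eq] at h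
  have h2 := h.unique (hasDerivAt_const _ _)
  simp only [map_one, Module.End.one_apply] at h2
  exact eq_neg_of_add_eq_zero_right h2

lemma exists_bound_infinitesimal (B : G.InvariantInnerProduct) :
    ∃ C, 0 ≤ C ∧ ∀ (v : V) (α : G.lieK), ‖A.infinitesimal v α‖ ≤ C * ‖v‖ * B.norm α := by
  let b := stdOrthonormalBasis ℂ V
  choose C hC hb using fun i => B.exists_bound (A.infinitesimal (b i))
  refine ⟨∑ i, C i, Finset.sum_nonneg fun i _ => hC i, fun v α => ?_⟩
  rw [← A.infinitesimalEnd_apply]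
  conv_lhs => rw [← b.sum_repr' v, map_sum]
  refine (norm_sum_le _ _).trans ?_
  rw [Finset.sum_mul, Finset.sum_mul]
  refine Finset.sum_le_sum fun i _ => ?_
  rw [map_smul, norm_smul, A.infinitesimalEnd_apply]
  have h1 : ‖inner ℂ (b i) v‖ ≤ ‖v‖ := by
    simpa using norm_inner_le_norm (𝕜 := ℂ) (b i) v
  calc ‖inner ℂ (b i) v‖ * ‖A.infinitesimal (b i) α‖ ≤ ‖v‖ * (C i * B.norm α) :=
        mul_le_mul h1 (hb i α) (norm_nonneg _) (norm_nonneg _)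
    _ = _ := by ring

/-- If `α_v = 0`, then `exp (tα)` fixes `v`. -/
lemma exp_apply_eq_self {v : V} {α : G.lieK} (h : A.infinitesimal v α = 0) (t : ℝ) :
    A.toHom (G.exp α t) v = v := by
  have hd : ∀ s : ℝ, HasDerivAt (fun t : ℝ => A.toHom (G.exp α t) v) 0 s := by
    -- The group law moves the derivative at `0` to `s`: it becomes `exp (sα)` applied to `α_v = 0`.
    intro s
    have h1 := A.hasDerivAt_infinitesimal v α
    rw [h] at h1
    have h2 := ((LinearMap.toContinuousLinearMap (A.toHom (G.exp α s))).restrictScalars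
      ℝ).hasFDerivAt.comp_hasDerivAt (0 : ℝ) h1
    rw [map_zero, ← sub_self s] at h2
    have h3 := HasDerivAt.comp_sub_const s s h2
    refine h3.congr_of_eventuallyEq (Eventually.of_forall fun t => ?_)
    change _ = A.toHom (G.exp α s) (A.toHom (G.exp α (t - s)) v)
    rw [← Module.End.mul_apply, ← map_mul, ← exp_add_eq, add_sub_cancel]
  have := is_const_of_deriv_eq_zero (fun s => (hd s).differentiableAt) (fun s => (hd s).deriv) t 0
  simpa [exp_zero_eq] using this

/-- Joint continuity of the action, from the continuity of matrix coefficients. It transports limits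
to a conjugate one-parameter subgroup. -/
lemma tendsto_apply {κ : Type*} {F : Filter κ} {u : κ → G.toSubgroup} {g : G.toSubgroup}
    {x : κ → V} {y : V}
    (h : Tendsto (fun k => (u k : GL (Fin n) ℂ).val) F (𝓝 (g : GL (Fin n) ℂ).val))
    (hx : Tendsto x F (𝓝 y)) :
    Tendsto (fun k => A.toHom (u k) (x k)) F (𝓝 (A.toHom g y)) := by
  let b := stdOrthonormalBasis ℂ V
  have hexp : ∀ (g : G.toSubgroup) (y : V), A.toHom g y =
      ∑ j, ∑ i, (inner ℂ (b j) y * inner ℂ (b i) (A.toHom g (b j))) • b i := by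
    intro g y
    conv_lhs => rw [← b.sum_repr' y, map_sum]
    refine Finset.sum_congr rfl fun j _ => ?_
    rw [map_smul]
    conv_lhs => rw [← b.sum_repr' (A.toHom g (b j)), Finset.smul_sum]
    simp [smul_smul]
  rw [hexp]
  simp only [hexp _ (x _)]
  refine tendsto_finsetSum _ fun j _ => tendsto_finsetSum _ fun i _ => Tendsto.smul_const ?_ _
  exact (tendsto_const_nhds.inner hx).mul ((A.regular (b j) (b i)).tendsto h)

/-- The weight decomposition of `V` under a one-parameter subgroup. -/
lemma exists_weights (l : G.OnePS) : ∃ (N : ℕ) (w : Fin (N + 1) → ℤ)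
    (P : Fin (N + 1) → Module.End ℂ V), Function.Injective w ∧
      CompleteOrthogonalIdempotents P ∧
      ∀ t : ℂˣ, A.toHom (l.toHom t) = ∑ j, ((t : ℂ) ^ w j) • P j := by
  let b := stdOrthonormalBasis ℂ V
  obtain ⟨N, k, c, hc⟩ := IsLaurent.exists_coeff
    (f := fun (ij : Fin (Module.finrank ℂ V) × Fin (Module.finrank ℂ V)) t =>
      inner ℂ (b ij.1) (A.toHom (l.toHom t) (b ij.2)))
    (fun ij => (A.regular (b ij.2) (b ij.1)).isLaurent l)
  have hw : Function.Injective fun j : Fin (N + 1) => (j : ℤ) - k :=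
    fun i j hij => Fin.ext (by simpa using hij)
  have h : ∀ t : ℂˣ, A.toHom (l.toHom t) = ∑ j : Fin (N + 1), ((t : ℂ) ^ ((j : ℤ) - k)) •
      (Matrix.toLin b.toBasis b.toBasis (Matrix.of fun a d => c (a, d) j) : Module.End ℂ V) := by
    intro t
    refine b.toBasis.ext fun d => b.toBasis.ext_elem fun a => ?_
    have := hc (a, d) t
    simp only [LinearMap.sum_apply, LinearMap.smul_apply, Matrix.toLin_self, map_sum, map_smul,
      Finsupp.coe_finsetSum, Finset.sum_apply, Finsupp.smul_apply, Matrix.of_apply,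
      Module.Basis.repr_self, Finsupp.single_apply]
    simp only [OrthonormalBasis.coe_toBasis, OrthonormalBasis.coe_toBasis_repr_apply,
      OrthonormalBasis.repr_apply_apply, this]
    simp
  exact ⟨N, _, _, hw, completeOrthogonalIdempotents_of_hom hw (A.toHom.comp l.toHom) h, h⟩

section Weights

variable {l : G.OnePS} {α : G.lieK} {ι : Type*} [Fintype ι] {w : ι → ℤ} {P : ι → Module.End ℂ V}

lemma infinitesimal_eq_sum
    (hl : ∀ t : ℝ, l.toHom (Circle.toUnits (Circle.exp (2 * Real.pi * t))) = G.exp α t)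
    (h : ∀ t : ℂˣ, A.toHom (l.toHom t) = ∑ j, ((t : ℂ) ^ w j) • P j) (x : V) :
    A.infinitesimal x α = ∑ j, (2 * Real.pi * Complex.I * w j) • P j x := by
  refine HasDerivAt.deriv ?_
  simp only [← hl, h, LinearMap.sum_apply, LinearMap.smul_apply]
  exact HasDerivAt.fun_sum fun j _ => (hasDerivAt_circle_zpow (w j)).smul_const (P j x)

/-- Weight spaces are eigenspaces of the skew-Hermitian operator `α` for the distinct eigenvalues
`2πi w j`. -/
lemma inner_weight_eq_zero
    (hl : ∀ t : ℝ, l.toHom (Circle.toUnits (Circle.exp (2 * Real.pi * t))) = G.exp α t)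
    (hw : Function.Injective w) (hP : CompleteOrthogonalIdempotents P)
    (h : ∀ t : ℂˣ, A.toHom (l.toHom t) = ∑ j, ((t : ℂ) ^ w j) • P j) {i j : ι} (hij : i ≠ j)
    (x y : V) : inner ℂ (P i x) (P j y) = 0 := by
  have h1 : ∀ k z, A.infinitesimalEnd α (P k z) = (2 * Real.pi * Complex.I * w k) • P k z := by
    intro k z
    rw [infinitesimalEnd_apply, A.infinitesimal_eq_sum hl h, Finset.sum_eq_single k]
    · rw [← Module.End.mul_apply, (hP.idem k).eq]
    · intro i _ hi
      rw [← Module.End.mul_apply, hP.ortho hi]; simp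
    · simp
  have h3 := A.inner_infinitesimal_left α (P i x) (P j y)
  rw [← infinitesimalEnd_apply, ← infinitesimalEnd_apply, h1, h1, inner_smul_left,
    inner_smul_right] at h3
  have h4 : (2 * Real.pi * Complex.I * ((w j : ℂ) - w i)) * inner ℂ (P i x) (P j y) = 0 := by
    have : (starRingEnd ℂ) (2 * Real.pi * Complex.I * w i) = -(2 * Real.pi * Complex.I * w i) := by
      simp [Complex.conj_ofNat]
    rw [this] at h3
    linear_combination h3
  refine (mul_eq_zero.1 h4).resolve_left (mul_ne_zero Complex.two_pi_I_ne_zero ?_)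
  rw [sub_ne_zero]
  exact_mod_cast fun h => hij (hw h).symm

/-- `t ^ (-w j) • P j (l t v)` is constantly `P j v`, whereas it tends to `0` when the weight is
negative. -/
lemma weight_eq_zero_of_hasLimit (hP : CompleteOrthogonalIdempotents P)
    (h : ∀ t : ℂˣ, A.toHom (l.toHom t) = ∑ j, ((t : ℂ) ^ w j) • P j) {v : V}
    (hv : A.HasLimit v l) {j : ι} (hj : w j < 0) : P j v = 0 := by
  obtain ⟨y, hy⟩ := hv
  have hc : Continuous (P j) := (P j).continuous_of_finiteDimensional
  have h1 := (tendsto_units_zpow (neg_pos.2 hj)).smul ((hc.tendsto y).comp hy)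
  rw [zero_smul] at h1
  have := neBot_comap_units_nhds_zero
  refine tendsto_nhds_unique (tendsto_const_nhds.congr fun t => ?_) h1
  have h2 : P j (A.toHom (l.toHom t) v) = ((t : ℂ) ^ w j) • P j v := by
    rw [h]
    exact LinearMap.congr_fun (mul_sum_smul hP.1 (fun j => (t : ℂ) ^ w j) j) v
  rw [Function.comp, h2, smul_smul, ← zpow_add₀ t.ne_zero, neg_add_cancel, zpow_zero, one_smul]

end Weights

end LinearAction

end ComplexReductiveGroup

lemma sum_idempotents_apply {ι V : Type*} [Fintype ι] [AddCommGroup V] [Module ℂ V]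
    {P : ι → Module.End ℂ V} (hP : CompleteOrthogonalIdempotents P) (x : V) : ∑ j, P j x = x := by
  rw [← LinearMap.sum_apply, hP.complete, Module.End.one_apply]

/-- Integral multiples of `1 / N` approximate a real number. -/
lemma tendsto_floor_mul_div (c : ℝ) :
    Tendsto (fun N : ℕ => (⌊c * N⌋ : ℝ) / N) atTop (𝓝 c) := by
  have h : Tendsto (fun N : ℕ => c - (N : ℝ)⁻¹) atTop (𝓝 c) := by
    simpa using (tendsto_inv_atTop_nhds_zero_nat (𝕜 := ℝ)).const_sub c
  refine tendsto_of_tendsto_of_tendsto_of_le_of_le' h tendsto_const_nhds ?_ ?_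
  · filter_upwards [eventually_gt_atTop 0] with N hN
    have hN' : (0 : ℝ) < N := by exact_mod_cast hN
    rw [le_div_iff₀ hN', sub_mul, inv_mul_cancel₀ hN'.ne']
    linarith [Int.lt_floor_add_one (c * N)]
  · filter_upwards [eventually_gt_atTop 0] with N hN
    rw [div_le_iff₀ (by exact_mod_cast hN)]
    exact Int.floor_le (c * N)

/-! ### Energy and the invariant `M` -/

namespace ComplexReductiveGroup

variable {n : ℕ} {G : ComplexReductiveGroup n}

namespace LinearAction

variable {V : Type*} [NormedAddCommGroup V] [InnerProductSpace ℂ V] [FiniteDimensional ℂ V]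
  (A : G.LinearAction V)

/-- The unshifted moment map `H(α_v, v) / (2πi)`. -/
def energy (α : G.lieK) (v : V) : ℝ :=
  (inner ℂ v (A.infinitesimal v α) / (2 * Real.pi * Complex.I)).re

lemma moment_apply (ρ : G.Character) (v : V) (α : G.lieK) :
    A.moment ρ v α = A.energy α v - (ρ.d α / (2 * Real.pi * Complex.I)).re := by
  change ((inner ℂ v (A.infinitesimal v α) - ρ.d α) / (2 * Real.pi * Complex.I)).re = _
  rw [sub_div, Complex.sub_re]
  rfl

lemma form_momentStar (ρ : G.Character) (B : G.InvariantInnerProduct) (v : V) (α : G.lieK) :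
    B.form (A.momentStar ρ B v) α = A.moment ρ v α :=
  B.form_toDual_symm _ _

lemma moment_eq_sub_pairing (ρ : G.Character) (v : V) {l : G.OnePS} {α : G.lieK}
    (hl : ∀ t : ℝ, l.toHom (Circle.toUnits (Circle.exp (2 * Real.pi * t))) = G.exp α t) :
    A.moment ρ v α = A.energy α v - ρ.pairing l := by
  rw [moment_apply, ρ.d_eq hl, mul_div_cancel_left₀ _ Complex.two_pi_I_ne_zero, Complex.intCast_re]

section Weights

variable {l : G.OnePS} {α : G.lieK} {ι : Type*} [Fintype ι] {w : ι → ℤ} {P : ι → Module.End ℂ V}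

lemma inner_weight_right
    (hl : ∀ t : ℝ, l.toHom (Circle.toUnits (Circle.exp (2 * Real.pi * t))) = G.exp α t)
    (hw : Function.Injective w) (hP : CompleteOrthogonalIdempotents P)
    (h : ∀ t : ℂˣ, A.toHom (l.toHom t) = ∑ j, ((t : ℂ) ^ w j) • P j) (x : V) (j : ι) :
    inner ℂ x (P j x) = ((‖P j x‖ ^ 2 : ℝ) : ℂ) := by
  conv_lhs => rw [← sum_idempotents_apply hP x, sum_inner]
  rw [Finset.sum_eq_single j]
  · rw [sum_idempotents_apply hP x, inner_self_eq_norm_sq_to_K]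
    norm_cast
  · intro i _ hij
    rw [sum_idempotents_apply hP x]
    exact A.inner_weight_eq_zero hl hw hP h hij _ _
  · simp

lemma energy_eq_sum
    (hl : ∀ t : ℝ, l.toHom (Circle.toUnits (Circle.exp (2 * Real.pi * t))) = G.exp α t)
    (hw : Function.Injective w) (hP : CompleteOrthogonalIdempotents P)
    (h : ∀ t : ℂˣ, A.toHom (l.toHom t) = ∑ j, ((t : ℂ) ^ w j) • P j) (x : V) :
    A.energy α x = ∑ j, (w j : ℝ) * ‖P j x‖ ^ 2 := by
  rw [energy, A.infinitesimal_eq_sum hl h, inner_sum, Finset.sum_div, Complex.re_sum]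
  refine Finset.sum_congr rfl fun j _ => ?_
  rw [inner_smul_right, A.inner_weight_right hl hw hP h, mul_assoc (2 * (Real.pi : ℂ) * Complex.I),
    mul_div_cancel_left₀ _ Complex.two_pi_I_ne_zero]
  norm_cast

lemma norm_sq_eq_sum
    (hl : ∀ t : ℝ, l.toHom (Circle.toUnits (Circle.exp (2 * Real.pi * t))) = G.exp α t)
    (hw : Function.Injective w) (hP : CompleteOrthogonalIdempotents P)
    (h : ∀ t : ℂˣ, A.toHom (l.toHom t) = ∑ j, ((t : ℂ) ^ w j) • P j) (x : V) :
    ‖x‖ ^ 2 = ∑ j, ‖P j x‖ ^ 2 := by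
  have h1 : ((‖x‖ ^ 2 : ℝ) : ℂ) = ∑ j, ((‖P j x‖ ^ 2 : ℝ) : ℂ) := by
    simp only [← A.inner_weight_right hl hw hP h]
    rw [← inner_sum, sum_idempotents_apply hP x, inner_self_eq_norm_sq_to_K]
    norm_cast
  exact_mod_cast h1

/-- If `lim l(t) v` exists, then the energy is non-negative and controls `α_v`. -/
lemma energy_estimate
    (hl : ∀ t : ℝ, l.toHom (Circle.toUnits (Circle.exp (2 * Real.pi * t))) = G.exp α t) {v : V}
    (hv : A.HasLimit v l) :
    0 ≤ A.energy α v ∧ (‖A.infinitesimal v α‖ ^ 2) ^ 2 ≤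
      (2 * Real.pi) ^ 2 * (A.energy α v * A.energy α (A.infinitesimal v α)) := by
  obtain ⟨N, w, P, hw, hP, h⟩ := A.exists_weights l
  have hPv : ∀ j, P j (A.infinitesimal v α) = (2 * Real.pi * Complex.I * w j) • P j v := by
    intro j
    rw [A.infinitesimal_eq_sum hl h]
    have := LinearMap.congr_fun
      (mul_sum_smul hP.1 (fun j => 2 * (Real.pi : ℂ) * Complex.I * w j) j) v
    simpa using this
  have hn : ∀ j, ‖P j (A.infinitesimal v α)‖ ^ 2 =
      (2 * Real.pi) ^ 2 * ((w j : ℝ) ^ 2 * ‖P j v‖ ^ 2) := by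
    intro j
    rw [hPv, norm_smul]
    simp only [norm_mul, Complex.norm_I, Complex.norm_real, Complex.norm_intCast,
      Real.norm_eq_abs, mul_pow, sq_abs]
    simp
    ring
  have hpos : ∀ j, 0 ≤ (w j : ℝ) * ‖P j v‖ ^ 2 := by
    intro j
    rcases lt_or_ge (w j) 0 with hj | hj
    · simp [A.weight_eq_zero_of_hasLimit hP h hv hj]
    · have : (0 : ℝ) ≤ w j := by exact_mod_cast hj
      positivity
  rw [A.energy_eq_sum hl hw hP h, A.energy_eq_sum hl hw hP h, A.norm_sq_eq_sum hl hw hP h]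
  refine ⟨Finset.sum_nonneg fun j _ => hpos j, ?_⟩
  simp only [hn]
  rw [← Finset.mul_sum, mul_pow]
  have h1 : ∑ j, (w j : ℝ) * ((2 * Real.pi) ^ 2 * ((w j : ℝ) ^ 2 * ‖P j v‖ ^ 2)) =
      (2 * Real.pi) ^ 2 * ∑ j, (w j : ℝ) ^ 2 * ((w j : ℝ) * ‖P j v‖ ^ 2) := by
    rw [Finset.mul_sum]
    exact Finset.sum_congr rfl fun j _ => by ring
  -- Cauchy-Schwarz in the form `(∑ w²‖v_j‖²)² ≤ (∑ w‖v_j‖²)(∑ w³‖v_j‖²)`, valid because every term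
  -- on the right is non-negative.
  have h2 := Finset.sum_sq_le_sum_mul_sum_of_sq_le_mul Finset.univ
    (r := fun j => (w j : ℝ) ^ 2 * ‖P j v‖ ^ 2) (fun j _ => hpos j)
    (fun j _ => mul_nonneg (sq_nonneg (w j : ℝ)) (hpos j)) (fun j _ => le_of_eq (by ring))
  rw [h1]
  calc _ ≤ ((2 * Real.pi) ^ 2) ^ 2 * _ := mul_le_mul_of_nonneg_left h2 (by positivity)
    _ = _ := by ring

end Weights

/-- The data attached to a one-parameter subgroup for which `lim l(t) v` exists. -/
lemma exists_generator (ρ : G.Character) (B : G.InvariantInnerProduct) {v : V} {l : G.OnePS}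
    (hv : A.HasLimit v l) :
    ∃ α : G.lieK, B.normOnePS l = B.norm α ∧
      B.form (A.momentStar ρ B v) α = A.energy α v - ρ.pairing l ∧
      0 ≤ A.energy α v ∧ (‖A.infinitesimal v α‖ ^ 2) ^ 2 ≤
        (2 * Real.pi) ^ 2 * (A.energy α v * A.energy α (A.infinitesimal v α)) := by
  obtain ⟨l', g, α, hconj, hα, hlim⟩ := l.exists_conj_compact
  -- `l'(t) v = (l'(t) l(t)⁻¹) (l(t) v)`, and both factors converge.
  have hv' : A.HasLimit v l' := by
    obtain ⟨y, hy⟩ := hv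
    refine ⟨A.toHom g y, (A.tendsto_apply hlim hy).congr fun t => ?_⟩
    rw [← Module.End.mul_apply, ← map_mul, inv_mul_cancel_right]
  refine ⟨α, B.normOnePS_eq g fun t => by rw [← hconj, hα], ?_, A.energy_estimate hα hv'⟩
  rw [form_momentStar, A.moment_eq_sub_pairing ρ v hα, ρ.pairing_eq_of_conj g hconj]

/-- Non-negative energy and Cauchy-Schwarz: `-(ρ, l) ≤ (β, α) ≤ ‖β‖ ‖α‖`. -/
lemma neg_norm_le (ρ : G.Character) (B : G.InvariantInnerProduct) {v : V} {l : G.OnePS}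
    (hv : A.HasLimit v l) :
    -B.norm (A.momentStar ρ B v) ≤ (ρ.pairing l : ℝ) / B.normOnePS l := by
  obtain ⟨α, hn, hf, hE, -⟩ := A.exists_generator ρ B hv
  rw [hn]
  rcases (B.norm_nonneg α).eq_or_lt with h0 | h0
  · rw [← h0, div_zero, neg_nonpos]
    exact B.norm_nonneg _
  · rw [le_div_iff₀ h0]
    have := (abs_le.1 (B.form_le (A.momentStar ρ B v) α)).2
    linarith

lemma neg_norm_le_M (ρ : G.Character) (B : G.InvariantInnerProduct) (v : V) :
    -B.norm (A.momentStar ρ B v) ≤ A.M ρ B v := by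
  rw [M]
  split_ifs with h
  · obtain ⟨l, hl⟩ := h
    refine le_csInf ⟨_, l, hl, rfl⟩ ?_
    rintro x ⟨l, hl, rfl⟩
    exact A.neg_norm_le ρ B hl
  · exact neg_nonpos.2 (B.norm_nonneg _)

lemma M_le (ρ : G.Character) (B : G.InvariantInnerProduct) {v : V} {l : G.OnePS}
    (hv : A.HasLimit v l) : A.M ρ B v ≤ (ρ.pairing l : ℝ) / B.normOnePS l := by
  rw [M, if_pos ⟨l, hv⟩]
  -- A lower bound is indispensable: the real infimum of a set unbounded below is `0` by convention.
  refine csInf_le ⟨-B.norm (A.momentStar ρ B v), ?_⟩ ⟨l, hv, rfl⟩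
  rintro x ⟨l, hl, rfl⟩
  exact A.neg_norm_le ρ B hl

/-- A one-parameter subgroup in the Zariski closure of a group that fixes `v` fixes `v`. -/
lemma onePS_apply_eq_self {v : V} {β : G.lieK} (hβ : A.infinitesimal v β = 0) {l : G.OnePS}
    (hl : ∀ p : MvPolynomial (Fin n × Fin n) ℂ,
      (∀ s : ℝ, MvPolynomial.eval (fun ij => (G.exp β s : GL (Fin n) ℂ).val ij.1 ij.2) p = 0) →
      ∀ t, MvPolynomial.eval (fun ij => (l.toHom t : GL (Fin n) ℂ).val ij.1 ij.2) p = 0) (t : ℂˣ) :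
    A.toHom (l.toHom t) v = v := by
  refine ext_inner_left ℂ fun x => ?_
  obtain ⟨p, k, hp⟩ := A.regular v x
  let d : MvPolynomial (Fin n × Fin n) ℂ := (Matrix.mvPolynomialX (Fin n) (Fin n) ℂ).det
  have hd : ∀ M : Matrix (Fin n) (Fin n) ℂ,
      MvPolynomial.eval (fun ij : Fin n × Fin n => M ij.1 ij.2) d = M.det := by
    intro M
    simp only [d, RingHom.map_det, Matrix.mvPolynomialX_mapMatrix_eval]
  -- After multiplication by `det ^ k`, the equation `⟨x, g v⟩ = ⟨x, v⟩` is polynomial in the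
  -- entries of `g`.
  have key : ∀ g : G.toSubgroup, inner ℂ x (A.toHom g v) = inner ℂ x v ↔
      MvPolynomial.eval (fun ij => (g : GL (Fin n) ℂ).val ij.1 ij.2)
        (p - MvPolynomial.C (inner ℂ x v) * d ^ k) = 0 := by
    intro g
    have hg : (g : GL (Fin n) ℂ).val.det ≠ 0 := Matrix.GeneralLinearGroup.det_ne_zero _
    rw [show inner ℂ x (A.toHom g v) = _ from hp g, map_sub, map_mul, map_pow, hd, MvPolynomial.eval_C, sub_eq_zero, inv_pow,
      ← div_eq_mul_inv, div_eq_iff (pow_ne_zero _ hg)]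
  refine (key _).2 (hl _ (fun s => (key _).1 ?_) t)
  rw [A.exp_apply_eq_self hβ]

/-- If `β = μ^*(v)` is non-zero and `β_v = 0`, then `M(v) ≤ -‖β‖`. -/
lemma M_le_neg_norm (ρ : G.Character) (B : G.InvariantInnerProduct) (v : V) {β : G.lieK}
    (hβ : β = A.momentStar ρ B v) (h0 : β ≠ 0) (hv : A.infinitesimal v β = 0) :
    A.M ρ B v ≤ -B.norm β := by
  obtain ⟨m, c, X, hc, hX⟩ := exists_onePS_in_torus β
  let S : (Fin m → ℝ) → G.lieK := fun c => ∑ k, c k • X k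
  -- The real-linear extension of the pairing with `ρ` from integral to real coefficients.
  let L : (Fin m → ℝ) → ℝ := fun c => (ρ.d (S c) / (2 * Real.pi * Complex.I)).re
  have hS : ∀ (r : ℝ) (c : Fin m → ℝ), S (r • c) = r • S c := by
    intro r c
    simp [S, Finset.smul_sum, smul_smul]
  have hL : ∀ (r : ℝ) (c : Fin m → ℝ), L (r • c) = r * L c := by
    intro r c
    simp only [L, hS, map_smul, Complex.real_smul]
    rw [mul_div_assoc, Complex.re_ofReal_mul]
  have hLc : Continuous L := by
    simp only [L, S, map_sum, map_smul]
    fun_prop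
  have hNc : Continuous fun c => B.norm (S c) := by
    simp only [InvariantInnerProduct.norm, S, map_sum, map_smul, LinearMap.sum_apply,
      LinearMap.smul_apply, smul_eq_mul]
    fun_prop
  have hNpos : 0 < B.norm (S c) := by
    rw [show S c = β from hc.symm]
    exact B.norm_pos h0
  have hlim : Tendsto (fun N : ℕ => (fun k => (⌊c k * N⌋ : ℝ) / N : Fin m → ℝ)) atTop (𝓝 c) :=
    tendsto_pi_nhds.2 fun k => tendsto_floor_mul_div (c k)
  -- `β_v = 0` removes the energy, so `‖β‖² = μ(v) · β` is minus the value of `ρ` on `β`.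
  have hL0 : L c = -B.norm β ^ 2 := by
    have h1 := A.form_momentStar ρ B v β
    rw [← hβ, moment_apply, energy, hv, inner_zero_right, zero_div, Complex.zero_re,
      ← B.norm_sq] at h1
    rw [h1]
    simp only [L]
    rw [show S c = β from hc.symm]
    ring
  have ht := ((hLc.tendsto c).comp hlim).div ((hNc.tendsto c).comp hlim) hNpos.ne'
  have hval : L c / B.norm (S c) = -B.norm β := by
    rw [hL0, show S c = β from hc.symm]
    have := (B.norm_pos h0).ne'
    field_simp
  rw [hval] at ht
  -- Each rational approximation of `c` is `q / N` with `q` integral. The ratio of pairing and norm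
  -- is homogeneous of degree zero, so it is the value of the one-parameter subgroup attached to
  -- `q`.
  refine ge_of_tendsto ht ?_
  filter_upwards [((hNc.tendsto c).comp hlim).eventually (lt_mem_nhds hNpos),
    eventually_gt_atTop 0] with N hN hN0
  have hN0' : (0 : ℝ) < N := by exact_mod_cast hN0
  let q : Fin m → ℤ := fun k => ⌊c k * N⌋
  have hq : (fun k => (⌊c k * N⌋ : ℝ) / N : Fin m → ℝ) = (N : ℝ)⁻¹ • fun k => (q k : ℝ) := by
    funext k
    simp [q, div_eq_inv_mul]
  simp only [Function.comp, Pi.div_apply] at hN ⊢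
  rw [hq, hS, B.norm_smul, abs_of_pos (inv_pos.2 hN0')] at hN
  have hSq : S (fun k => (q k : ℝ)) ≠ 0 := by
    intro h
    rw [h] at hN
    simp [InvariantInnerProduct.norm] at hN
  obtain ⟨l, hl, hvan⟩ := hX q hSq
  have hlv : A.HasLimit v l := ⟨v, tendsto_const_nhds.congr fun t =>
    (A.onePS_apply_eq_self hv hvan t).symm⟩
  refine (A.M_le ρ B hlv).trans_eq ?_
  rw [hq, hL, hS, B.norm_smul, abs_of_pos (inv_pos.2 hN0'),
    mul_div_mul_left _ _ (inv_pos.2 hN0').ne',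
    B.normOnePS_eq (l := l) 1 (fun t => by rw [one_mul, inv_one, mul_one, hl t])]
  congr 1
  simp only [L, S]
  rw [ρ.d_eq hl, mul_div_cancel_left₀ _ Complex.two_pi_I_ne_zero, Complex.intCast_re]

/-- If `-M(v) = ‖μ^*(v)‖ > 0`, then `μ^*(v)` annihilates `v`. -/
lemma infinitesimal_eq_zero_of_M_eq (ρ : G.Character) (B : G.InvariantInnerProduct) (v : V)
    {β : G.lieK} (hβ : β = A.momentStar ρ B v) (hM : -A.M ρ B v = B.norm β)
    (hpos : 0 < B.norm β) : A.infinitesimal v β = 0 := by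
  obtain ⟨C, hC, hCb⟩ := A.exists_bound_infinitesimal B
  set r := B.norm β with hr
  have hex : ∃ l, A.HasLimit v l := by
    by_contra h
    rw [M, if_neg h, neg_zero] at hM
    exact hpos.ne hM
  -- For `l` within `ε` of the infimum, the two summands bound the action on `v` of `α/‖α‖` and of
  -- the difference `β/‖β‖ - α/‖α‖`.
  have key : ∀ ε : ℝ, 0 < ε → ε < r →
      ‖A.infinitesimal v (r⁻¹ • β)‖ ≤
        √(2 * Real.pi * C * ε) + C * ‖v‖ * √(2 * ε / r) := by
    intro ε hε hεr
    obtain ⟨x, ⟨l, hl, rfl⟩, hx⟩ : ∃ x ∈ {x : ℝ | ∃ l : G.OnePS, A.HasLimit v l ∧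
        x = (ρ.pairing l : ℝ) / B.normOnePS l}, x < -r + ε := by
      refine exists_lt_of_csInf_lt ?_ ?_
      · obtain ⟨l, hl⟩ := hex
        exact ⟨_, l, hl, rfl⟩
      · rw [M, if_pos hex] at hM
        linarith
    obtain ⟨α, hn, hf, hE, hest⟩ := A.exists_generator ρ B hl
    rw [← hβ] at hf
    rw [hn] at hx
    -- Were the norm zero, the quotient would be `0` by convention, which is not below `-r + ε < 0`.
    have hα : 0 < B.norm α := by
      refine (B.norm_nonneg α).lt_of_ne fun h => ?_
      rw [← h, div_zero] at hx
      linarith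
    rw [div_lt_iff₀ hα] at hx
    have hcs : B.form β α ≤ r * B.norm α := (abs_le.1 (B.form_le β α)).2
    -- In `E(v) = (β, α) + (ρ, l)` the first term is at most `r‖α‖` and the second is less than `(ε
    -- - r)‖α‖`; together with `E(v) ≥ 0` this also gives the next bound.
    have hEle : A.energy α v ≤ ε * B.norm α := by nlinarith
    have hfge : (r - ε) * B.norm α ≤ B.form β α := by nlinarith
    have hE2 : A.energy α (A.infinitesimal v α) ≤
        (2 * Real.pi)⁻¹ * (C * ‖A.infinitesimal v α‖ ^ 2 * B.norm α) := by
      set y := A.infinitesimal v α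
      refine (Complex.re_le_norm _).trans ?_
      rw [norm_div, div_eq_inv_mul]
      have h1 : ‖(2 * Real.pi * Complex.I : ℂ)‖ = 2 * Real.pi := by
        simp [abs_of_pos Real.pi_pos]
      rw [h1]
      refine mul_le_mul_of_nonneg_left ?_ (by positivity)
      calc ‖inner ℂ y (A.infinitesimal y α)‖ ≤ ‖y‖ * ‖A.infinitesimal y α‖ := norm_inner_le_norm _ _
        _ ≤ ‖y‖ * (C * ‖y‖ * B.norm α) := mul_le_mul_of_nonneg_left (hCb y α) (norm_nonneg _)
        _ = _ := by ring
    -- The energy estimate has `‖α_v‖⁴` on the left and at most a multiple of `‖α_v‖²` on the right;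
    -- one factor `‖α_v‖²` cancels.
    have hα2 : ‖A.infinitesimal v α‖ ^ 2 ≤ 2 * Real.pi * C * ε * B.norm α ^ 2 := by
      set Y := ‖A.infinitesimal v α‖ ^ 2 with hY
      have hY0 : 0 ≤ Y := by positivity
      rcases hY0.eq_or_lt with h0 | h0
      · rw [← h0]; have := Real.pi_pos; positivity
      refine le_of_mul_le_mul_right ?_ h0
      calc Y * Y = Y ^ 2 := by ring
        _ ≤ (2 * Real.pi) ^ 2 * (A.energy α v * A.energy α (A.infinitesimal v α)) := hest
        _ ≤ (2 * Real.pi) ^ 2 * (A.energy α v * ((2 * Real.pi)⁻¹ * (C * Y * B.norm α))) := by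
            gcongr
        _ ≤ (2 * Real.pi) ^ 2 * (ε * B.norm α * ((2 * Real.pi)⁻¹ * (C * Y * B.norm α))) := by
            have := Real.pi_pos
            gcongr
        _ = _ := by
            have := Real.pi_ne_zero
            field_simp
    have hα3 : ‖A.infinitesimal v ((B.norm α)⁻¹ • α)‖ ≤ √(2 * Real.pi * C * ε) := by
      refine Real.le_sqrt_of_sq_le ?_
      rw [map_smul, norm_smul, mul_pow, norm_inv, Real.norm_of_nonneg hα.le, inv_pow,
        inv_mul_le_iff₀ (by positivity)]
      linarith
    -- For unit vectors the squared distance is `2 - 2(·,·)`, and here the inner product is at least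
    -- `1 - ε/r`.
    have hdist : B.norm (r⁻¹ • β - (B.norm α)⁻¹ • α) ≤ √(2 * ε / r) := by
      refine Real.sqrt_le_sqrt ?_
      have h1 := B.norm_sq α
      have h2 := B.norm_sq β
      simp only [map_sub, map_smul, LinearMap.sub_apply, LinearMap.smul_apply, smul_eq_mul]
      rw [B.symm α β, ← h1, ← h2, ← hr]
      have h3 : (r - ε) ≤ (B.norm α)⁻¹ * B.form β α := by
        rw [le_inv_mul_iff₀ hα]; linarith
      have h4 : r⁻¹ * ((r - ε)) ≤ r⁻¹ * ((B.norm α)⁻¹ * B.form β α) :=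
        mul_le_mul_of_nonneg_left h3 (by positivity)
      have e1 : r⁻¹ * (r⁻¹ * r ^ 2) = 1 := by field_simp
      have e2 : (B.norm α)⁻¹ * ((B.norm α)⁻¹ * B.norm α ^ 2) = 1 := by field_simp
      have e3 : r⁻¹ * (r - ε) = 1 - ε / r := by field_simp
      have e4 : 2 * ε / r = 2 * (ε / r) := by ring
      have e5 : (B.norm α)⁻¹ * (r⁻¹ * B.form β α) = r⁻¹ * ((B.norm α)⁻¹ * B.form β α) := by ring
      rw [mul_sub, mul_sub, e1, e2, e4, e5]
      rw [e3] at h4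
      linarith
    calc ‖A.infinitesimal v (r⁻¹ • β)‖
        = ‖A.infinitesimal v ((B.norm α)⁻¹ • α) +
            A.infinitesimal v (r⁻¹ • β - (B.norm α)⁻¹ • α)‖ := by
          rw [← map_add, add_sub_cancel]
      _ ≤ _ := (norm_add_le _ _).trans (add_le_add hα3 ((hCb _ _).trans
          (mul_le_mul_of_nonneg_left hdist (by positivity))))
  have hlim : Tendsto (fun ε : ℝ => √(2 * Real.pi * C * ε) + C * ‖v‖ * √(2 * ε / r))
      (𝓝[>] 0) (𝓝 0) := by
    have hc : Continuous fun ε : ℝ => √(2 * Real.pi * C * ε) + C * ‖v‖ * √(2 * ε / r) := by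
      fun_prop
    have := hc.tendsto 0
    simp only [mul_zero, zero_div, Real.sqrt_zero, add_zero] at this
    exact this.mono_left nhdsWithin_le_nhds
  have h0 : ‖A.infinitesimal v (r⁻¹ • β)‖ ≤ 0 := by
    refine ge_of_tendsto hlim ?_
    filter_upwards [Ioo_mem_nhdsGT hpos] with ε hε
    exact key ε hε.1 hε.2
  rw [norm_le_zero_iff, map_smul, smul_eq_zero] at h0
  exact h0.resolve_left (inv_ne_zero hpos.ne')

/-! ### The derivative of `‖μ‖²` -/

/-- Skew-Hermitian symmetry makes the derivative of `⟨x, α_x⟩` equal to `z - conj z = 2i Im z` with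
`z = ⟨y, α_v⟩`; division by `2πi` leaves `Im z / π`. -/
lemma hasFDerivAt_moment (ρ : G.Character) (v : V) (α : G.lieK) :
    ∃ D : V →L[ℝ] ℝ, HasFDerivAt (fun x => A.moment ρ x α) D v ∧
      ∀ y, D y = (inner ℂ y (A.infinitesimal v α) : ℂ).im / Real.pi := by
  let L : V →L[ℝ] V :=
    (LinearMap.toContinuousLinearMap (A.infinitesimalEnd α)).restrictScalars ℝ
  have h1 := (hasFDerivAt_id (𝕜 := ℝ) v).inner ℂ (L.hasFDerivAt (x := v))
  let R : ℂ →L[ℝ] ℝ := Complex.reCLM.comp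
    (((2 * Real.pi * Complex.I : ℂ)⁻¹) • (ContinuousLinearMap.id ℝ ℂ))
  have h2 := (R.hasFDerivAt.comp v h1).sub_const (ρ.d α / (2 * Real.pi * Complex.I)).re
  refine ⟨_, h2.congr_of_eventuallyEq (Eventually.of_forall fun x => ?_), fun y => ?_⟩
  · change A.moment ρ x α = ((2 * Real.pi * Complex.I : ℂ)⁻¹ *
      inner ℂ x (A.infinitesimal x α)).re - _
    rw [moment_apply, energy, div_eq_inv_mul]
  · change ((2 * Real.pi * Complex.I : ℂ)⁻¹ *
      (inner ℂ v (A.infinitesimal y α) + inner ℂ y (A.infinitesimal v α))).re = _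
    have h3 : inner ℂ v (A.infinitesimal y α) =
        -(starRingEnd ℂ) (inner ℂ y (A.infinitesimal v α)) := by
      rw [inner_conj_symm, A.inner_infinitesimal_left, neg_neg]
    rw [h3]
    set z : ℂ := inner ℂ y (A.infinitesimal v α)
    have h4 : -(starRingEnd ℂ) z + z = ((2 * z.im : ℝ) : ℂ) * Complex.I := by
      apply Complex.ext <;> simp
      ring
    have hpi : (Real.pi : ℂ) ≠ 0 := by exact_mod_cast Real.pi_ne_zero
    have h5 : (2 * Real.pi * Complex.I : ℂ)⁻¹ * (((2 * z.im : ℝ) : ℂ) * Complex.I) =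
        ((z.im / Real.pi : ℝ) : ℂ) := by
      have := Complex.I_ne_zero
      push_cast
      field_simp
    rw [h4, h5, Complex.ofReal_re]

/-- With `β = μ^*(v)` fixed, `‖μ(x)‖² = 2 μ(x)·β - ‖β‖² + ‖μ^*(x) - β‖²`. The last term vanishes to
second order at `v`, so only `μ(x)·β` contributes. -/
lemma hasFDerivAt_normSqMoment (ρ : G.Character) (B : G.InvariantInnerProduct) (v : V) :
    ∃ D : V →L[ℝ] ℝ, HasFDerivAt (A.normSqMoment ρ B) D v ∧
      ∀ y, D y = 2 * ((inner ℂ y (A.infinitesimal v (A.momentStar ρ B v)) : ℂ).im / Real.pi) := by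
  set β := A.momentStar ρ B v with hβ
  obtain ⟨D, hD, hDy⟩ := A.hasFDerivAt_moment ρ v β
  let b := Module.finBasis ℝ G.lieK
  let y := fun i => (B.form.toDual B.nondegenerate).symm (b.coord i)
  choose D' hD' _ using fun i => A.hasFDerivAt_moment ρ v (y i)
  have hcoord : ∀ x i, b.repr (A.momentStar ρ B x - β) i =
      A.moment ρ x (y i) - A.moment ρ v (y i) := by
    intro x i
    rw [← form_momentStar _ _ B, ← form_momentStar _ _ B, ← LinearMap.sub_apply, ← map_sub,
      B.symm]
    exact (B.form_toDual_symm (b.coord i) _).symm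
  have hdecomp : A.normSqMoment ρ B = fun x => 2 * A.moment ρ x β - B.form β β +
      ∑ i, ∑ j, (A.moment ρ x (y i) - A.moment ρ v (y i)) *
        (A.moment ρ x (y j) - A.moment ρ v (y j)) * B.form (b i) (b j) := by
    funext x
    have h1 : B.form (A.momentStar ρ B x - β) (A.momentStar ρ B x - β) =
        ∑ i, ∑ j, (A.moment ρ x (y i) - A.moment ρ v (y i)) *
          (A.moment ρ x (y j) - A.moment ρ v (y j)) * B.form (b i) (b j) := by
      conv_lhs => rw [← b.sum_repr (A.momentStar ρ B x - β)]
      simp only [map_sum, map_smul, LinearMap.sum_apply, LinearMap.smul_apply, smul_eq_mul, hcoord]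
      simp only [Finset.mul_sum]
      rw [Finset.sum_comm]
      refine Finset.sum_congr rfl fun i _ => Finset.sum_congr rfl fun j _ => ?_
      ring
    rw [← h1, normSqMoment, B.norm_sq, ← A.form_momentStar ρ B]
    simp only [map_sub, LinearMap.sub_apply]
    rw [B.symm β (A.momentStar ρ B x)]
    ring
  have hquad : HasFDerivAt (fun x => ∑ i, ∑ j, (A.moment ρ x (y i) - A.moment ρ v (y i)) *
      (A.moment ρ x (y j) - A.moment ρ v (y j)) * B.form (b i) (b j)) (0 : V →L[ℝ] ℝ) v := by
    have := HasFDerivAt.fun_sum (u := Finset.univ) fun i _ =>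
      HasFDerivAt.fun_sum (u := Finset.univ) fun j _ =>
        (((hD' i).sub_const (A.moment ρ v (y i))).mul
          ((hD' j).sub_const (A.moment ρ v (y j)))).mul_const (B.form (b i) (b j))
    simp only [sub_self, zero_smul, add_zero, smul_zero, Finset.sum_const_zero] at this
    exact this
  refine ⟨(2 : ℝ) • D, ?_, fun y => by simp [hDy]⟩
  rw [hdecomp]
  have := ((hD.const_mul 2).sub_const (B.form β β)).add hquad
  rwa [add_zero] at this

/-- `v` is a critical point of `‖μ‖²` if and only if `μ^*(v)` annihilates `v`. -/
lemma isCritical_iff (ρ : G.Character) (B : G.InvariantInnerProduct) (v : V) :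
    A.IsCritical ρ B v ↔ A.infinitesimal v (A.momentStar ρ B v) = 0 := by
  obtain ⟨D, hD, hDy⟩ := A.hasFDerivAt_normSqMoment ρ B v
  constructor
  · intro h
    have h0 : D = 0 := hD.unique h
    -- In the direction `iβ_v` the derivative is `-2‖β_v‖²/π`.
    have h1 := hDy (Complex.I • A.infinitesimal v (A.momentStar ρ B v))
    rw [h0, inner_smul_left, inner_self_eq_norm_sq_to_K] at h1
    set x := A.infinitesimal v (A.momentStar ρ B v)
    have h2 : ((starRingEnd ℂ) Complex.I * ((‖x‖ : ℂ)) ^ 2).im = -‖x‖ ^ 2 := by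
      rw [Complex.conj_I, ← Complex.ofReal_pow, neg_mul, Complex.neg_im, Complex.I_mul_im,
        Complex.ofReal_re]
    have h3 : (0 : ℝ) = 2 * (-‖x‖ ^ 2 / Real.pi) := by
      rw [← h2]; exact h1
    have h4 : ‖x‖ ^ 2 = 0 := by
      have := Real.pi_ne_zero
      field_simp at h3
      linarith
    exact norm_eq_zero.1 (pow_eq_zero_iff two_ne_zero |>.1 h4)
  · intro h
    have h0 : D = 0 := by
      ext y
      rw [hDy, h]
      simp
    rw [IsCritical, ← h0]
    exact hD

lemma moment_eq_zero_iff (ρ : G.Character) (B : G.InvariantInnerProduct) (v : V) :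
    A.moment ρ v = 0 ↔ A.momentStar ρ B v = 0 := by
  rw [momentStar, LinearEquiv.map_eq_zero_iff]

end LinearAction

end ComplexReductiveGroup

end

end ReductiveAction

/-! ### Equivalence of the three conditions -/

open ReductiveAction
theorem theorem4p6 {n : ℕ} (G : ComplexReductiveGroup n)
    {V : Type*} [NormedAddCommGroup V] [InnerProductSpace ℂ V] [FiniteDimensional ℂ V]
    (A : G.LinearAction V) (ρ : G.Character) (B : G.InvariantInnerProduct)
    (v : V) (β : G.lieK) (hβ : β = A.momentStar ρ B v) :
    List.TFAE [
      A.IsNonMinimalCritical ρ B v,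
      β ≠ 0 ∧ A.infinitesimal v β = 0,
      -A.M ρ B v = B.norm β ∧ 0 < B.norm β] := by
  tfae_have 1 ↔ 2 := by
    rw [ComplexReductiveGroup.LinearAction.IsNonMinimalCritical, A.isCritical_iff, Ne,
      A.moment_eq_zero_iff ρ B, ← hβ, and_comm]
  tfae_have 2 → 3 := by
    rintro ⟨h0, hv⟩
    have h1 := A.M_le_neg_norm ρ B v hβ h0 hv
    have h2 := A.neg_norm_le_M ρ B v
    rw [← hβ] at h2
    exact ⟨by linarith, B.norm_pos h0⟩
  tfae_have 3 → 2 := by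
    rintro ⟨hM, hpos⟩
    refine ⟨?_, A.infinitesimal_eq_zero_of_M_eq ρ B v hβ hM hpos⟩
    rintro rfl
    simp [ComplexReductiveGroup.InvariantInnerProduct.norm] at hpos
  tfae_finish
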